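/- Let $\Gamma$ be a finite simplicial graph and let $G=\mathbb{A}(\Gamma)=\langle v\in V(\Gamma)\mid [v,w]=1 \text{ whenever } vw \text{ is an edge of } \Gamma\rangle$ be its right-angled Artin group, with the standard generating set $S=V(\Gamma)^{\pm1}$, word length $\Vert g\Vert$ and word metric $d(x,y)=\Vert x^{-1}y\Vert$. The growth rate of $G$ is $\lambda(G)=\lim_{n\to\infty}\big(\#\{g\in G:\Vert g\Vert\le n\}\big)^{1/n}$, and $P_n$ denotes the uniform probability on the sphere $\{g\in G:\Vert g\Vert=n\}$. For a vertex $v$ and $g\in G$, the excursion of $g$ in $\langle v\rangle$ is $$\mathcal{E}_v(g)=\max_{\gamma}\max_{t\in G}\operatorname{diam}(\gamma\cap t\langle v\rangle),$$ where $\gamma$ runs over the geodesic segments from $1$ to $g$ in the Cayley graph of $(G,S)$. Assume that $G$ is non-abelian and let $v$ be a vertex of $\Gamma$. Let $\Gamma_v$ be the subgraph of $\Gamma$ induced on the vertices lying in the connected component of $v$ in the complement graph $\Gamma^{\mathrm{op}}$, so that $\mathbb{A}(\Gamma_v)$ is the irreducible direct factor of $G$ containing $v$; its growth rate is taken with respect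 to its own standard generators. Then: 1. if $\lambda(\mathbb{A}(\Gamma_v))=\lambda(\mathbb{A}(\Gamma))$, then there exist constants $0<c_1<c_2$ such that $$P_n\big(g\in G:\ c_1\log n\le \mathcal{E}_v(g)\le c_2\log n\big)\to 1\qquad (n\to\infty);$$ 2. if $\lambda(\mathbb{A}(\Gamma_v))<\lambda(\mathbb{A}(\Gamma))$, then $$\liminf_{n\to\infty}P_n\big(g\in G:\ \mathcal{E}_v(g)=0\big)>0.$$ -/

import Mathlib

open Filter Topology
open scoped Pointwise

namespace RAAG

section Groups

variable {G : Type*} [Group G]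

/-- The word length `‖g‖` of `g` with respect to a symmetric generating set `S`: the least `k` such
that `g` is a product of `k` elements of `S`. -/
noncomputable def wordLength (S : Set G) (g : G) : ℕ :=
  sInf {k : ℕ | ∃ l : List G, l.length = k ∧ (∀ s ∈ l, s ∈ S) ∧ l.prod = g}

/-- The word metric `d(x, y) = ‖x⁻¹ y‖`, i.e. the edge metric on the Cayley graph. -/
noncomputable def wordDist (S : Set G) (x y : G) : ℕ :=
  wordLength S (x⁻¹ * y)

/-- The ball of radius `n` about the identity. -/
def ball (S : Set G) (n : ℕ) : Set G := {g | wordLength S g ≤ n}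

/-- The sphere of radius `n` about the identity. -/
def sphere (S : Set G) (n : ℕ) : Set G := {g | wordLength S g = n}

/-- The growth rate `lim (# B_n) ^ (1 / n)` (for finite `S` the limit exists by
submultiplicativity). -/
noncomputable def growthRate (S : Set G) : ℝ :=
  limUnder atTop fun n : ℕ => ((ball S n).ncard : ℝ) ^ (1 / (n : ℝ))

/-- The uniform probability `P_n` on the sphere of radius `n`, evaluated at the event `A`. -/
noncomputable def sphereProb (S : Set G) (n : ℕ) (A : Set G) : ℝ :=
  ((sphere S n ∩ A).ncard : ℝ) / ((sphere S n).ncard : ℝ)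

/-- `γ 0, …, γ n`, where `n = ‖g‖`, are the successive vertices of a geodesic segment from `1` to
`g` in the Cayley graph (the values `γ i` for `i > n` play no role). -/
def IsGeodesicTo (S : Set G) (g : G) (γ : ℕ → G) : Prop :=
  γ 0 = 1 ∧ γ (wordLength S g) = g ∧
    ∀ i j : ℕ, i ≤ j → j ≤ wordLength S g → wordDist S (γ i) (γ j) = j - i

/-- The diameter of a subset in the word metric. -/
noncomputable def diam (S : Set G) (A : Set G) : ℕ :=
  sSup {d : ℕ | ∃ x ∈ A, ∃ y ∈ A, d = wordDist S x y}

/-- The excursion into `H` of the segment with vertices `γ 0, …, γ n`: the maximum over `t` of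
`diam (γ ∩ t H)`. -/
noncomputable def pathExcursion (S : Set G) (H : Subgroup G) (n : ℕ) (γ : ℕ → G) : ℕ :=
  sSup {d : ℕ | ∃ t : G, d = diam S (γ '' Set.Iic n ∩ t • (H : Set G))}

/-- The excursion of `g` in `H`: the maximum of the excursions into `H` of the geodesic segments
joining `1` and `g`. -/
noncomputable def excursion (S : Set G) (H : Subgroup G) (g : G) : ℕ :=
  sSup {d : ℕ | ∃ γ : ℕ → G, IsGeodesicTo S g γ ∧ d = pathExcursion S H (wordLength S g) γ}

end Groups

section Artin

variable {V : Type*}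

/-- The right-angled Artin group of `Γ`: generators are the vertices of `Γ`, and the relations are
`[v, w] = 1` for every edge `vw`. -/
abbrev ArtinGroup (Γ : SimpleGraph V) : Type _ :=
  PresentedGroup {r : FreeGroup V | ∃ v w, Γ.Adj v w ∧
    r = FreeGroup.of v * FreeGroup.of w * (FreeGroup.of v)⁻¹ * (FreeGroup.of w)⁻¹}

/-- The generator of the right-angled Artin group attached to a vertex. -/
def gen (Γ : SimpleGraph V) (v : V) : ArtinGroup Γ := PresentedGroup.of v

/-- The standard symmetric generating set: the vertices and their inverses. -/
def stdGens (Γ : SimpleGraph V) : Set (ArtinGroup Γ) :=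
  {g | ∃ v, g = gen Γ v ∨ g = (gen Γ v)⁻¹}

/-- The subgraph of `Γ` induced on the vertices that lie in the same connected component as `v` in
the opposite (complement) graph; its Artin group is the irreducible factor containing `v`. -/
def factorGraph (Γ : SimpleGraph V) (v : V) : SimpleGraph {w : V | Γᶜ.Reachable v w} :=
  Γ.induce {w : V | Γᶜ.Reachable v w}

/-- The growth rate of the right-angled Artin group for the standard generators. -/
noncomputable def artinGrowthRate (Γ : SimpleGraph V) : ℝ := growthRate (stdGens Γ)

/-- The excursion of `g` in the vertex group `⟨v⟩`. -/
noncomputable def vertexExcursion (Γ : SimpleGraph V) (v : V) (g : ArtinGroup Γ) : ℕ :=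
  excursion (stdGens Γ) (Subgroup.zpowers (gen Γ v)) g

end Artin

end RAAG

/-! Cutting a geodesic where it meets a coset of ⟨v⟩ shows that, for k ≥ 1, the excursion of g is at
least k exactly when some geodesic word for g contains v^k or v^(-k) as a subword (`HasPow`). So the
theorem is about counting. The group is the product of A(Γ_v) and the group on the remaining
vertices, lengths add, and `HasPow` sees only the component in A(Γ_v) (`hasPow_iff`).

The factor A(Γ_v) is irreducible. A walk in the complement graph through all vertices spells a lock:
put in front of an element, without cancellation, it leaves only one possible first letter
(`exists_lock`). Gluing two elements through locks can be undone up to a choice of signs, so sphere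
sizes are supermultiplicative up to a constant as well as submultiplicative, and they agree with λ^n
up to a constant factor (`exists_sph_bounds`).

Long powers are rare: an element a v^k b of length n is determined by a, b and the place of the cut,
which gives a proportion O(n λ^(-k)). Missing powers are rare too. Insert a locked v^k at each of
the m+1 places of an element of length m that has no v^k; the result has length m+k+O(1), and each
value occurs O(k) times, because two insertion places differ by a bounded element and part of v^k
(`exists_eq_mul_pow`). This gives a proportion O(k λ^k / m). Both errors vanish when k is a small,
respectively large, multiple of log n.

For the whole group, sphere sizes are convolutions over the two factors. If A(Γ_v) attains the
growth rate, its component is longer than √n with probability tending to 1, because the normalised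
sphere sizes of the other factor do not concentrate (`spread_sph`). If it grows more slowly, a
geometric series shows that elements with trivial component in A(Γ_v) form a positive proportion,
and these have excursion 0. -/

namespace RAAG

/-! ### Words, letters and word length in a right-angled Artin group -/

section Letters

variable {V : Type*} {Γ : SimpleGraph V}

/-- The word length in a right-angled Artin group. -/
noncomputable abbrev len (g : ArtinGroup Γ) : ℕ := wordLength (stdGens Γ) g

/-- The inverse of a letter. -/
def flip (x : V × Bool) : V × Bool := (x.1, !x.2)

@[simp] theorem flip_flip (x : V × Bool) : flip (flip x) = x := by simp [flip]

@[simp] theorem flip_fst (x : V × Bool) : (flip x).1 = x.1 := rfl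

theorem flip_ne (x : V × Bool) : flip x ≠ x := by
  intro h
  have := congrArg Prod.snd h
  simp [flip] at this

variable (Γ) in
/-- The generator or inverse generator given by a letter. -/
def letter (x : V × Bool) : ArtinGroup Γ := cond x.2 (gen Γ x.1) (gen Γ x.1)⁻¹

@[simp] theorem letter_flip (x : V × Bool) : letter Γ (flip x) = (letter Γ x)⁻¹ := by
  obtain ⟨v, _ | _⟩ := x <;> simp [letter, flip]

theorem letter_true (v : V) : letter Γ (v, true) = gen Γ v := rfl

theorem letter_mem (x : V × Bool) : letter Γ x ∈ stdGens Γ := by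
  obtain ⟨v, _ | _⟩ := x
  · exact ⟨v, Or.inr rfl⟩
  · exact ⟨v, Or.inl rfl⟩

theorem exists_letter {s : ArtinGroup Γ} (hs : s ∈ stdGens Γ) : ∃ x, letter Γ x = s := by
  obtain ⟨v, rfl | rfl⟩ := hs
  · exact ⟨(v, true), rfl⟩
  · exact ⟨(v, false), rfl⟩

theorem gen_commute {v w : V} (h : Γ.Adj v w) : Commute (gen Γ v) (gen Γ w) := by
  have : (PresentedGroup.mk {r : FreeGroup V | ∃ v w, Γ.Adj v w ∧
    r = FreeGroup.of v * FreeGroup.of w * (FreeGroup.of v)⁻¹ * (FreeGroup.of w)⁻¹})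
      (FreeGroup.of v * FreeGroup.of w * (FreeGroup.of v)⁻¹ * (FreeGroup.of w)⁻¹) = 1 :=
    PresentedGroup.one_of_mem ⟨v, w, h, rfl⟩
  simp only [map_mul, map_inv] at this
  rw [mul_inv_eq_one, mul_inv_eq_iff_eq_mul] at this
  exact this

theorem letter_commute {x y : V × Bool} (h : Γ.Adj x.1 y.1) :
    Commute (letter Γ x) (letter Γ y) := by
  have := gen_commute h
  obtain ⟨v, _ | _⟩ := x <;> obtain ⟨w, _ | _⟩ := y <;> simp only [letter, cond] <;>
    simpa using this

variable (Γ) in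
/-- The group element spelled by a word. -/
def word (l : List (V × Bool)) : ArtinGroup Γ := (l.map (letter Γ)).prod

@[simp] theorem word_nil : word Γ [] = 1 := rfl

@[simp] theorem word_cons (x : V × Bool) (l : List (V × Bool)) :
    word Γ (x :: l) = letter Γ x * word Γ l := by simp [word]

@[simp] theorem word_append (l m : List (V × Bool)) :
    word Γ (l ++ m) = word Γ l * word Γ m := by simp [word]

theorem letter_induction {p : ArtinGroup Γ → Prop} (h1 : p 1)
    (hm : ∀ x g, p g → p (letter Γ x * g)) (g : ArtinGroup Γ) : p g := by
  have : ∀ f : FreeGroup V, ∀ g : ArtinGroup Γ, p g → p (PresentedGroup.mk _ f * g) := by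
    intro f
    induction f using FreeGroup.induction_on with
    | C1 => intro g hg; simpa using hg
    | of x => intro g hg; exact hm (x, true) g hg
    | inv_of x _ => intro g hg; rw [map_inv]; exact hm (x, false) g hg
    | mul x y hx hy => intro g hg; rw [map_mul, mul_assoc]; exact hx _ (hy _ hg)
  induction g using PresentedGroup.induction_on with
  | _ z => simpa using this z 1 h1

theorem exists_word (g : ArtinGroup Γ) : ∃ l, word Γ l = g := by
  induction g using letter_induction with
  | h1 => exact ⟨[], rfl⟩
  | hm x g ih => obtain ⟨l, rfl⟩ := ih; exact ⟨x :: l, by simp⟩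

theorem len_word_le (l : List (V × Bool)) : len (word Γ l) ≤ l.length := by
  apply Nat.sInf_le
  refine ⟨l.map (letter Γ), by simp, ?_, rfl⟩
  intro s hs
  obtain ⟨x, _, rfl⟩ := List.mem_map.1 hs
  exact letter_mem x

theorem exists_geodesic_word (g : ArtinGroup Γ) : ∃ l, word Γ l = g ∧ l.length = len g := by
  have hne : {k : ℕ | ∃ l : List (ArtinGroup Γ), l.length = k ∧ (∀ s ∈ l, s ∈ stdGens Γ) ∧
      l.prod = g}.Nonempty := by
    obtain ⟨l, rfl⟩ := exists_word g
    refine ⟨_, l.map (letter Γ), rfl, ?_, rfl⟩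
    intro s hs
    obtain ⟨x, _, rfl⟩ := List.mem_map.1 hs
    exact letter_mem x
  obtain ⟨l, hl, hS, hp⟩ := Nat.sInf_mem hne
  have : ∀ l : List (ArtinGroup Γ), (∀ s ∈ l, s ∈ stdGens Γ) →
      ∃ m : List (V × Bool), m.map (letter Γ) = l := by
    intro l
    induction l with
    | nil => intro _; exact ⟨[], rfl⟩
    | cons a l ih =>
      intro h
      obtain ⟨m, rfl⟩ := ih fun s hs => h s (by simp [hs])
      obtain ⟨x, rfl⟩ := exists_letter (h a (by simp))
      exact ⟨x :: m, by simp⟩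
  obtain ⟨m, rfl⟩ := this l hS
  exact ⟨m, hp, (List.length_map _).symm.trans hl⟩

@[simp] theorem len_one : len (1 : ArtinGroup Γ) = 0 := by
  have := len_word_le (Γ := Γ) []
  simpa using this

theorem len_eq_zero {g : ArtinGroup Γ} : len g = 0 ↔ g = 1 := by
  refine ⟨fun h => ?_, fun h => by rw [h, len_one]⟩
  obtain ⟨l, rfl, hl⟩ := exists_geodesic_word g
  rw [h, List.length_eq_zero_iff] at hl
  simp [hl]

theorem len_mul_le (g h : ArtinGroup Γ) : len (g * h) ≤ len g + len h := by
  obtain ⟨l, rfl, hl⟩ := exists_geodesic_word g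
  obtain ⟨m, rfl, hm⟩ := exists_geodesic_word h
  rw [← word_append, ← hl, ← hm, ← List.length_append]
  exact len_word_le _

theorem len_letter_le (x : V × Bool) : len (letter Γ x) ≤ 1 := by
  simpa using len_word_le (Γ := Γ) [x]

theorem len_inv_le (g : ArtinGroup Γ) : len g⁻¹ ≤ len g := by
  obtain ⟨l, rfl, hl⟩ := exists_geodesic_word g
  rw [← hl]
  clear hl
  induction l with
  | nil => simp
  | cons x l ih =>
    rw [word_cons, mul_inv_rev, ← letter_flip]
    calc _ ≤ _ := len_mul_le _ _
      _ ≤ _ := Nat.add_le_add ih (len_letter_le _)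
      _ = _ := rfl

@[simp] theorem len_inv (g : ArtinGroup Γ) : len g⁻¹ = len g :=
  le_antisymm (len_inv_le g) (by simpa using len_inv_le g⁻¹)

/-- A map on the generators that respects the commutation relations extends to the group. -/
def lift {H : Type*} [Group H] (f : V → H) (hf : ∀ v w, Γ.Adj v w → Commute (f v) (f w)) :
    ArtinGroup Γ →* H :=
  PresentedGroup.toGroup (f := f) (by
    rintro r ⟨v, w, h, rfl⟩
    have := hf v w h
    simp only [map_mul, map_inv, FreeGroup.lift_apply_of]
    rw [mul_inv_eq_one, mul_inv_eq_iff_eq_mul]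
    exact this)

@[simp] theorem lift_gen {H : Type*} [Group H] (f : V → H)
    (hf : ∀ v w, Γ.Adj v w → Commute (f v) (f w)) (v : V) : lift f hf (gen Γ v) = f v :=
  PresentedGroup.toGroup.of _

end Letters

/-! ### Pilings: a normal form that decides which letters can start a geodesic word -/

section Piling

variable {V : Type*} {Γ : SimpleGraph V}

variable (Γ) in
/-- The pairs of non-adjacent vertices that contain the vertex of the letter `x`. -/
def Sees (x : V × Bool) (a b : V) : Prop := (a = x.1 ∨ b = x.1) ∧ ¬Γ.Adj a b

/-- Commuting letters touch disjoint sets of stacks, so their pushes and pops do not interfere. -/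
theorem Sees.not_sees {x y : V × Bool} (h : Γ.Adj x.1 y.1) {a b : V} (hx : Sees Γ x a b) :
    ¬Sees Γ y a b := by
  rintro ⟨h3, -⟩
  obtain ⟨h1, h2⟩ := hx
  rcases h1 with rfl | rfl <;> rcases h3 with h3 | h3
  · exact h.ne h3
  · exact h2 (h3 ▸ h)
  · exact h2 (h3 ▸ h.symm)
  · exact h.ne h3

/-- Letters that do not commute, and letters on the same vertex, share the stack indexed by their
own two vertices; that stack remembers their order. -/
theorem exists_sees {x y : V × Bool} (h : ¬Γ.Adj x.1 y.1) :
    ∃ a b, Sees Γ x a b ∧ Sees Γ y a b :=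
  ⟨x.1, y.1, ⟨Or.inl rfl, h⟩, ⟨Or.inr rfl, h⟩⟩

open Classical in
variable (Γ) in
/-- Put the letter `x` on all the stacks that it meets. -/
noncomputable def push (x : V × Bool) (P : V → V → List (V × Bool)) :
    V → V → List (V × Bool) :=
  fun a b => if Sees Γ x a b then x :: P a b else P a b

open Classical in
variable (Γ) in
/-- Remove the top of all the stacks that the letter `x` meets. -/
noncomputable def pop (x : V × Bool) (P : V → V → List (V × Bool)) :
    V → V → List (V × Bool) :=
  fun a b => if Sees Γ x a b then (P a b).tail else P a b

variable (Γ) in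
/-- The letter `x` is on the top of all the stacks that it meets. -/
def Top (x : V × Bool) (P : V → V → List (V × Bool)) : Prop :=
  ∀ a b, Sees Γ x a b → (P a b).head? = some x

theorem top_push_self (x : V × Bool) (P : V → V → List (V × Bool)) : Top Γ x (push Γ x P) := by
  intro a b h
  simp [push, h]

theorem pop_push_self (x : V × Bool) (P : V → V → List (V × Bool)) :
    pop Γ x (push Γ x P) = P := by
  funext a b
  by_cases h : Sees Γ x a b <;> simp [push, pop, h]

theorem push_pop_self {x : V × Bool} {P : V → V → List (V × Bool)} (h : Top Γ x P) :
    push Γ x (pop Γ x P) = P := by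
  funext a b
  by_cases hs : Sees Γ x a b
  · have := h a b hs
    simp only [push, pop, hs, if_true]
    cases hP : P a b with
    | nil => simp [hP] at this
    | cons c l => simp [hP] at this; simp [this]
  · simp [push, pop, hs]

theorem top_push_iff {x y : V × Bool} (h : Γ.Adj x.1 y.1) (P : V → V → List (V × Bool)) :
    Top Γ x (push Γ y P) ↔ Top Γ x P := by
  refine forall_congr' fun a => forall_congr' fun b => forall_congr' fun hs => ?_
  simp [push, hs.not_sees h]

theorem top_pop_iff {x y : V × Bool} (h : Γ.Adj x.1 y.1) (P : V → V → List (V × Bool)) :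
    Top Γ x (pop Γ y P) ↔ Top Γ x P := by
  refine forall_congr' fun a => forall_congr' fun b => forall_congr' fun hs => ?_
  simp [pop, hs.not_sees h]

theorem push_push {x y : V × Bool} (h : Γ.Adj x.1 y.1) (P : V → V → List (V × Bool)) :
    push Γ x (push Γ y P) = push Γ y (push Γ x P) := by
  funext a b
  by_cases hs : Sees Γ x a b
  · simp [push, hs, hs.not_sees h]
  · simp [push, hs]

theorem pop_push {x y : V × Bool} (h : Γ.Adj x.1 y.1) (P : V → V → List (V × Bool)) :
    pop Γ x (push Γ y P) = push Γ y (pop Γ x P) := by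
  funext a b
  by_cases hs : Sees Γ x a b
  · simp [push, pop, hs, hs.not_sees h]
  · simp [push, pop, hs]

theorem pop_pop {x y : V × Bool} (h : Γ.Adj x.1 y.1) (P : V → V → List (V × Bool)) :
    pop Γ x (pop Γ y P) = pop Γ y (pop Γ x P) := by
  funext a b
  by_cases hs : Sees Γ x a b
  · simp [pop, hs, hs.not_sees h]
  · simp [pop, hs]

theorem adj_of_top_push {x y : V × Bool} {P : V → V → List (V × Bool)}
    (h : Top Γ x (push Γ y P)) (hne : x ≠ y) : Γ.Adj x.1 y.1 := by
  by_contra hadj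
  obtain ⟨a, b, hx, hy⟩ := exists_sees hadj
  have := h a b hx
  simp only [push, hy, if_true, List.head?_cons, Option.some.injEq] at this
  exact hne this.symm

variable (Γ) in
/-- The piling `P` of a reduced word of length `n` that spells `g`. -/
inductive Piled : (V → V → List (V × Bool)) → ArtinGroup Γ → ℕ → Prop
  | nil : Piled (fun _ _ => []) 1 0
  | cons {P : V → V → List (V × Bool)} {g : ArtinGroup Γ} {n : ℕ} (x : V × Bool) :
      Piled P g n → ¬Top Γ (flip x) P → Piled (push Γ x P) (letter Γ x * g) (n + 1)

theorem not_top_nil (x : V × Bool) : ¬Top Γ x fun _ _ => [] := by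
  intro h
  have := h x.1 x.1 ⟨Or.inl rfl, Γ.irrefl⟩
  simp at this

/-- A letter `x` on top lies below only letters commuting with it, so it can be slid to the front of
the reduced word and removed. The last clause says that putting `x` back is again a reduced push. -/
theorem Piled.pop_of_top {P : V → V → List (V × Bool)} {g : ArtinGroup Γ} {n : ℕ}
    (h : Piled Γ P g n) {x : V × Bool} (hx : Top Γ x P) :
    ∃ m, n = m + 1 ∧ Piled Γ (pop Γ x P) ((letter Γ x)⁻¹ * g) m ∧
      ¬Top Γ (flip x) (pop Γ x P) := by
  induction h with
  | nil => exact absurd hx (not_top_nil x)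
  | @cons P g n y hP hy ih =>
    by_cases hxy : x = y
    · subst hxy
      refine ⟨n, rfl, ?_, ?_⟩
      · rw [pop_push_self, inv_mul_cancel_left]; exact hP
      · rw [pop_push_self]; exact hy
    · have hadj := adj_of_top_push hx hxy
      obtain ⟨m, rfl, hp, ht⟩ := ih ((top_push_iff hadj P).1 hx)
      refine ⟨m + 1, rfl, ?_, ?_⟩
      · have e : (letter Γ x)⁻¹ * (letter Γ y * g) = letter Γ y * ((letter Γ x)⁻¹ * g) := by
          rw [← mul_assoc, ← mul_assoc, (letter_commute hadj).inv_left.eq]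
        rw [pop_push hadj, e]
        refine Piled.cons y hp ?_
        rw [top_pop_iff (by simpa using hadj.symm)]
        exact hy
      · rw [pop_push hadj, top_push_iff (by simpa using hadj)]
        exact ht

/-- The length can be read off the piling alone: pop the outermost letter of one word from the
other. The two group elements are not yet known to agree. -/
theorem Piled.unique_length {P : V → V → List (V × Bool)} {g g' : ArtinGroup Γ} {n n' : ℕ}
    (h : Piled Γ P g n) (h' : Piled Γ P g' n') : n = n' := by
  induction h generalizing g' n' with
  | nil =>
    generalize hQ : (fun _ _ => [] : V → V → List (V × Bool)) = Q at h'
    cases h' with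
    | nil => rfl
    | cons x _ _ => exact absurd (hQ ▸ top_push_self x _) (not_top_nil x)
  | @cons P g n x hP hx ih =>
    obtain ⟨m, rfl, hm, -⟩ := h'.pop_of_top (top_push_self x P)
    rw [pop_push_self] at hm
    rw [ih hm]

variable (Γ) in
/-- The pilings of reduced words. -/
abbrev Pilings := {P : V → V → List (V × Bool) // ∃ g n, Piled Γ P g n}

open Classical in
variable (Γ) in
/-- Left multiplication by a letter on pilings. -/
noncomputable def act (x : V × Bool) (P : V → V → List (V × Bool)) :
    V → V → List (V × Bool) :=
  if Top Γ (flip x) P then pop Γ (flip x) P else push Γ x P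

theorem Piled.act {P : V → V → List (V × Bool)} {g : ArtinGroup Γ} {n : ℕ}
    (h : Piled Γ P g n) (x : V × Bool) :
    ∃ m ≤ n + 1, Piled Γ (act Γ x P) (letter Γ x * g) m := by
  by_cases hx : Top Γ (flip x) P
  · obtain ⟨m, rfl, hm, -⟩ := h.pop_of_top hx
    refine ⟨m, by omega, ?_⟩
    simpa [RAAG.act, hx] using hm
  · refine ⟨n + 1, le_rfl, ?_⟩
    simpa [RAAG.act, hx] using Piled.cons x h hx

/-- Reducedness matters here: after a pop, the inverse of the popped letter must not be on top, or
the second step would pop again. -/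
theorem act_flip_act {P : V → V → List (V × Bool)} {g : ArtinGroup Γ} {n : ℕ}
    (h : Piled Γ P g n) (x : V × Bool) : act Γ (flip x) (act Γ x P) = P := by
  by_cases hx : Top Γ (flip x) P
  · obtain ⟨m, rfl, hm, ht⟩ := h.pop_of_top hx
    rw [flip_flip] at ht
    simp [act, hx, ht, push_pop_self hx]
  · simp [act, hx, top_push_self, pop_push_self]

theorem act_act {x y : V × Bool} (h : Γ.Adj x.1 y.1) (P : V → V → List (V × Bool)) :
    act Γ x (act Γ y P) = act Γ y (act Γ x P) := by
  have h1 : Γ.Adj (flip x).1 y.1 := h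
  have h2 : Γ.Adj (flip x).1 (flip y).1 := h
  have h3 : Γ.Adj x.1 (flip y).1 := h
  by_cases hx : Top Γ (flip x) P <;> by_cases hy : Top Γ (flip y) P
  · simp [act, hx, hy, top_pop_iff h2, top_pop_iff h2.symm, pop_pop h2]
  · simp [act, hx, hy, top_push_iff h1, top_pop_iff h2.symm, pop_push h1]
  · simp [act, hx, hy, top_pop_iff h2, top_push_iff h3.symm, ← pop_push h3.symm]
  · simp [act, hx, hy, top_push_iff h1, top_push_iff h3.symm, push_push h]

variable (Γ) in
/-- The permutation of the pilings given by a letter. -/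
noncomputable def actPerm (x : V × Bool) : Equiv.Perm (Pilings Γ) where
  toFun P := ⟨act Γ x P.1, by
    obtain ⟨g, n, h⟩ := P.2
    obtain ⟨m, -, hm⟩ := h.act x
    exact ⟨_, _, hm⟩⟩
  invFun P := ⟨act Γ (flip x) P.1, by
    obtain ⟨g, n, h⟩ := P.2
    obtain ⟨m, -, hm⟩ := h.act (flip x)
    exact ⟨_, _, hm⟩⟩
  left_inv P := by
    obtain ⟨P, g, n, h⟩ := P
    exact Subtype.ext (act_flip_act h x)
  right_inv P := by
    obtain ⟨P, g, n, h⟩ := P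
    exact Subtype.ext (by simpa using act_flip_act h (flip x))

variable (Γ) in
/-- The action of the group on pilings. -/
noncomputable def pilingAction : ArtinGroup Γ →* Equiv.Perm (Pilings Γ) :=
  lift (fun v => actPerm Γ (v, true)) fun v w h => by
    ext P : 2
    exact act_act (x := (v, true)) (y := (w, true)) h P.1

theorem pilingAction_letter (x : V × Bool) : pilingAction Γ (letter Γ x) = actPerm Γ x := by
  obtain ⟨v, _ | _⟩ := x
  · exact (map_inv _ _).trans (congrArg _ (lift_gen _ _ v))
  · exact lift_gen _ _ v

/-- Acting on the empty piling replays the reduced word push by push, so the piling depends only on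
the group element. -/
theorem Piled.eq_action {P : V → V → List (V × Bool)} {g : ArtinGroup Γ} {n : ℕ}
    (h : Piled Γ P g n) : (pilingAction Γ g ⟨_, 1, 0, .nil⟩).1 = P := by
  induction h with
  | nil => simp
  | @cons P g n x hP hx ih =>
    rw [map_mul, Equiv.Perm.mul_apply, pilingAction_letter]
    change RAAG.act Γ x _ = _
    rw [ih]
    simp [RAAG.act, hx]

theorem exists_piled (l : List (V × Bool)) : ∃ P, ∃ n ≤ l.length, Piled Γ P (word Γ l) n := by
  induction l with
  | nil => exact ⟨_, 0, le_rfl, .nil⟩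
  | cons x l ih =>
    obtain ⟨P, n, hn, hP⟩ := ih
    obtain ⟨m, hm, h⟩ := hP.act x
    exact ⟨_, m, by simp; omega, by simpa using h⟩

theorem Piled.len_le {P : V → V → List (V × Bool)} {g : ArtinGroup Γ} {n : ℕ}
    (h : Piled Γ P g n) : len g ≤ n := by
  induction h with
  | nil => simp
  | @cons P g n x hP hx ih =>
    have := len_mul_le (letter Γ x) g
    have := len_letter_le (Γ := Γ) x
    omega

/-- Reduced words are geodesic: a geodesic word yields a piling no longer than itself, and it must
be the same piling. -/
theorem Piled.len_eq {P : V → V → List (V × Bool)} {g : ArtinGroup Γ} {n : ℕ}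
    (h : Piled Γ P g n) : len g = n := by
  refine le_antisymm h.len_le ?_
  obtain ⟨l, rfl, hl⟩ := exists_geodesic_word g
  obtain ⟨P', n', hn', h'⟩ := exists_piled (Γ := Γ) l
  have : P = P' := h.eq_action.symm.trans h'.eq_action
  subst this
  rw [h.unique_length h', ← hl]
  exact hn'

theorem exists_piled_len (g : ArtinGroup Γ) : ∃ P, Piled Γ P g (len g) := by
  obtain ⟨l, rfl⟩ := exists_word g
  obtain ⟨P, n, -, h⟩ := exists_piled (Γ := Γ) l
  exact ⟨P, by rwa [h.len_eq]⟩

variable (Γ) in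
/-- The letter `x` starts a geodesic word for `g`. -/
def Starts (x : V × Bool) (g : ArtinGroup Γ) : Prop := len ((letter Γ x)⁻¹ * g) + 1 = len g

theorem Piled.starts_iff {P : V → V → List (V × Bool)} {g : ArtinGroup Γ} {n : ℕ}
    (h : Piled Γ P g n) (x : V × Bool) : Starts Γ x g ↔ Top Γ x P := by
  rw [Starts, h.len_eq]
  constructor
  · intro hs
    by_contra hx
    have := (Piled.cons (flip x) h (by simpa using hx)).len_eq
    rw [letter_flip] at this
    omega
  · intro hx
    obtain ⟨m, rfl, hm, -⟩ := h.pop_of_top hx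
    rw [hm.len_eq]

theorem len_letter_mul {x : V × Bool} {g : ArtinGroup Γ} (h : ¬Starts Γ (flip x) g) :
    len (letter Γ x * g) = len g + 1 := by
  obtain ⟨P, hP⟩ := exists_piled_len g
  rw [hP.starts_iff] at h
  exact (Piled.cons x hP h).len_eq

/-- Both letters are on top of all their stacks, so they cannot share one. -/
theorem Starts.adj {x y : V × Bool} {g : ArtinGroup Γ} (hx : Starts Γ x g) (hy : Starts Γ y g)
    (hne : x ≠ y) : Γ.Adj x.1 y.1 := by
  obtain ⟨P, hP⟩ := exists_piled_len g
  rw [hP.starts_iff] at hx hy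
  rw [← push_pop_self hy] at hx
  exact adj_of_top_push hx hne

/-- No assumption on cancellation is needed: whether `y` is pushed or its inverse popped, the stacks
of `x` stay untouched. -/
theorem starts_mul_iff {x y : V × Bool} {g : ArtinGroup Γ} (h : Γ.Adj x.1 y.1) :
    Starts Γ x (letter Γ y * g) ↔ Starts Γ x g := by
  obtain ⟨P, hP⟩ := exists_piled_len g
  rw [hP.starts_iff]
  obtain ⟨m, -, hm⟩ := hP.act y
  rw [hm.starts_iff, act]
  split_ifs
  · exact top_pop_iff (by simpa using h) P
  · exact top_push_iff h P

end Piling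

/-! ### Reduced products, geodesic prefixes and when prefixes are nested -/

section Prefixes

variable {V : Type*} {Γ : SimpleGraph V}

theorem len_le_len_letter_mul (x : V × Bool) (g : ArtinGroup Γ) :
    len g ≤ len (letter Γ x * g) + 1 := by
  have h1 := len_mul_le (letter Γ x)⁻¹ (letter Γ x * g)
  have h2 := len_letter_le (Γ := Γ) x
  rw [inv_mul_cancel_left, len_inv] at h1
  omega

theorem Starts.not_flip {x : V × Bool} {g : ArtinGroup Γ} (h : Starts Γ x g) :
    ¬Starts Γ (flip x) g := fun h' => (h.adj h' (flip_ne x).symm).ne rfl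

theorem starts_letter_mul {x : V × Bool} {g : ArtinGroup Γ} (h : ¬Starts Γ (flip x) g) :
    Starts Γ x (letter Γ x * g) := by
  rw [Starts, inv_mul_cancel_left, len_letter_mul h]

theorem not_starts_of_len {x : V × Bool} {g : ArtinGroup Γ}
    (h : len (letter Γ x * g) = len g + 1) : ¬Starts Γ (flip x) g := by
  intro hs
  rw [Starts, letter_flip, inv_inv] at hs
  omega

theorem not_starts_inv_mul {x : V × Bool} {g : ArtinGroup Γ} (h : Starts Γ x g) :
    ¬Starts Γ (flip x) ((letter Γ x)⁻¹ * g) :=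
  not_starts_of_len (by rw [mul_inv_cancel_left]; exact h.symm)

theorem Starts.of_mul {x y : V × Bool} {g : ArtinGroup Γ} (h : Starts Γ x (letter Γ y * g))
    (hne : x ≠ y) (hy : ¬Starts Γ (flip y) g) : Γ.Adj x.1 y.1 ∧ Starts Γ x g := by
  have hadj := h.adj (starts_letter_mul hy) hne
  exact ⟨hadj, (starts_mul_iff hadj).1 h⟩

theorem exists_starts {g : ArtinGroup Γ} (h : g ≠ 1) : ∃ x, Starts Γ x g := by
  obtain ⟨l, rfl, hl⟩ := exists_geodesic_word g
  cases l with
  | nil => exact absurd rfl h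
  | cons x l =>
    refine ⟨x, ?_⟩
    have h1 := len_word_le (Γ := Γ) l
    have h2 := len_le_len_letter_mul x (word Γ l)
    have h3 := len_mul_le (letter Γ x) (word Γ l)
    have h4 := len_letter_le (Γ := Γ) x
    rw [Starts, word_cons, inv_mul_cancel_left]
    rw [word_cons, List.length_cons] at hl
    omega

theorem geodesic_induction {p : ArtinGroup Γ → Prop} (h1 : p 1)
    (hm : ∀ x g, ¬Starts Γ (flip x) g → p g → p (letter Γ x * g)) (g : ArtinGroup Γ) : p g := by
  induction hn : len g generalizing g with
  | zero => rw [len_eq_zero] at hn; rwa [hn]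
  | succ n ih =>
    have hg : g ≠ 1 := by rintro rfl; simp at hn
    obtain ⟨x, hx⟩ := exists_starts hg
    have := hm x _ (not_starts_inv_mul hx) (ih _ (by rw [Starts] at hx; omega))
    rwa [mul_inv_cancel_left] at this

/-- The product of `a` and `b` is reduced. -/
def Red (a b : ArtinGroup Γ) : Prop := len (a * b) = len a + len b

/-- `p` is a geodesic prefix of `g`. -/
def Pre (p g : ArtinGroup Γ) : Prop := len p + len (p⁻¹ * g) = len g

variable (Γ) in
/-- The letter `x` ends a geodesic word for `g`. -/
def Ends (x : V × Bool) (g : ArtinGroup Γ) : Prop := Starts Γ (flip x) g⁻¹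

theorem Red.symm {a b : ArtinGroup Γ} (h : Red a b) : Red b⁻¹ a⁻¹ := by
  rw [Red, ← mul_inv_rev, len_inv, len_inv, len_inv, h, add_comm]

theorem Red.pre {a b : ArtinGroup Γ} (h : Red a b) : Pre a (a * b) := by
  rw [Pre, inv_mul_cancel_left]; exact Eq.symm h

theorem Pre.red {p g : ArtinGroup Γ} (h : Pre p g) : Red p (p⁻¹ * g) := by
  rw [Red, mul_inv_cancel_left]; exact h.symm

theorem pre_one (g : ArtinGroup Γ) : Pre 1 g := by simp [Pre]

theorem pre_refl (g : ArtinGroup Γ) : Pre g g := by simp [Pre]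

theorem Red.assoc_right {a b c : ArtinGroup Γ} (h1 : Red a b) (h2 : Red (a * b) c) :
    Red a (b * c) := by
  have h3 := len_mul_le b c
  have h4 := len_mul_le a (b * c)
  rw [Red] at *
  rw [← mul_assoc] at *
  omega

theorem Red.assoc_left {a b c : ArtinGroup Γ} (h1 : Red b c) (h2 : Red a (b * c)) :
    Red (a * b) c := by
  have h3 := len_mul_le a b
  have h4 := len_mul_le (a * b) c
  rw [Red] at *
  rw [← mul_assoc] at *
  omega

@[simp] theorem len_letter (x : V × Bool) : len (letter Γ x) = 1 := by
  have : ¬Starts Γ (flip x) (1 : ArtinGroup Γ) := by simp [Starts]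
  simpa using len_letter_mul this

theorem Red.starts {a b : ArtinGroup Γ} (h : Red a b) {x : V × Bool} (hx : Starts Γ x a) :
    Starts Γ x (a * b) := by
  have h1 := len_mul_le ((letter Γ x)⁻¹ * a) b
  have h2 := len_le_len_letter_mul (flip x) (a * b)
  rw [letter_flip] at h2
  rw [Red] at h
  rw [Starts] at *
  rw [mul_assoc] at h1
  omega

theorem Red.ends {a b : ArtinGroup Γ} (h : Red a b) {x : V × Bool} (hx : Ends Γ x b) :
    Ends Γ x (a * b) := by
  rw [Ends, mul_inv_rev]
  exact h.symm.starts hx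

theorem ends_mul_iff {x y : V × Bool} {g : ArtinGroup Γ} (h : Γ.Adj x.1 y.1) :
    Ends Γ x (g * letter Γ y) ↔ Ends Γ x g := by
  rw [Ends, mul_inv_rev, ← letter_flip, starts_mul_iff (by simpa using h), Ends]

theorem Ends.of_mul {x y : V × Bool} {g : ArtinGroup Γ} (h : Ends Γ x (g * letter Γ y))
    (hne : x ≠ y) (hy : ¬Ends Γ (flip y) g) : Γ.Adj x.1 y.1 ∧ Ends Γ x g := by
  rw [Ends, mul_inv_rev, ← letter_flip] at h
  refine h.of_mul (fun e => hne ?_) hy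
  simpa using congrArg flip e

theorem red_letter {a : ArtinGroup Γ} {x : V × Bool} (h : ¬Ends Γ (flip x) a) :
    Red a (letter Γ x) := by
  rw [Ends] at h
  have := len_letter_mul h
  rw [letter_flip, ← mul_inv_rev, len_inv, len_inv] at this
  rw [Red, this, len_letter]

/-- Cancellation is visible in single letters: move the letters of `b` to `a` one at a time. A new
last letter of `a` is either the one just moved or commutes with it. -/
theorem red_of_not_ends {a b : ArtinGroup Γ}
    (h : ∀ x, Ends Γ x a → ¬Starts Γ (flip x) b) : Red a b := by
  induction b using geodesic_induction generalizing a with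
  | h1 => simp [Red]
  | hm z b hz ih =>
    have hza : ¬Ends Γ (flip z) a := fun he =>
      h _ he (by rw [flip_flip]; exact starts_letter_mul hz)
    have hr : Red a (letter Γ z) := red_letter hza
    refine hr.assoc_right (ih fun x hx hs => ?_)
    by_cases hxz : x = z
    · exact hz (hxz ▸ hs)
    · obtain ⟨hadj, hxa⟩ := hx.of_mul hxz hza
      exact h x hxa ((starts_mul_iff (by simpa using hadj)).2 hs)

variable (Γ) in
/-- The word is geodesic. -/
def Geo (l : List (V × Bool)) : Prop := len (word Γ l) = l.length

theorem Geo.tail {x : V × Bool} {l : List (V × Bool)} (h : Geo Γ (x :: l)) : Geo Γ l := by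
  have h1 := len_mul_le (letter Γ x) (word Γ l)
  have h2 := len_word_le (Γ := Γ) l
  have h3 := len_letter (Γ := Γ) x
  rw [Geo] at *
  rw [word_cons, List.length_cons] at h
  omega

theorem Geo.not_starts {x : V × Bool} {l : List (V × Bool)} (h : Geo Γ (x :: l)) :
    ¬Starts Γ (flip x) (word Γ l) := by
  have h1 := h.tail
  rw [Geo] at *
  rw [word_cons, List.length_cons, ← h1] at h
  exact not_starts_of_len h

theorem Geo.starts {x : V × Bool} {l : List (V × Bool)} (h : Geo Γ (x :: l)) :
    Starts Γ x (word Γ (x :: l)) := by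
  rw [word_cons]
  exact starts_letter_mul h.not_starts

theorem Starts.mem {x : V × Bool} {l : List (V × Bool)} (h : Starts Γ x (word Γ l))
    (hl : Geo Γ l) : x ∈ l := by
  induction l with
  | nil => simp [Starts] at h
  | cons y l ih =>
    by_cases hxy : x = y
    · simp [hxy]
    · rw [word_cons] at h
      exact List.mem_cons_of_mem _ (ih (h.of_mul hxy hl.not_starts).2 hl.tail)

theorem word_inv (l : List (V × Bool)) : (word Γ l)⁻¹ = word Γ (l.map flip).reverse := by
  induction l with
  | nil => simp
  | cons x l ih => simp [ih]

theorem Ends.mem {x : V × Bool} {l : List (V × Bool)} (h : Ends Γ x (word Γ l))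
    (hl : Geo Γ l) : x ∈ l := by
  rw [Ends, word_inv] at h
  have hm := h.mem (by rw [Geo, ← word_inv, len_inv, hl]; simp)
  simp only [List.mem_reverse, List.mem_map] at hm
  obtain ⟨y, hy, he⟩ := hm
  have : y = x := by simpa using congrArg flip he
  exact this ▸ hy

theorem exists_ends {g : ArtinGroup Γ} (h : g ≠ 1) : ∃ x, Ends Γ x g := by
  obtain ⟨x, hx⟩ := exists_starts (inv_ne_one.2 h)
  exact ⟨flip x, by rwa [Ends, flip_flip]⟩

theorem Pre.starts {p g : ArtinGroup Γ} (h : Pre p g) {x : V × Bool} (hx : Starts Γ x p) :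
    Starts Γ x g := by
  have := h.red.starts hx
  rwa [mul_inv_cancel_left] at this

theorem Pre.tail {x : V × Bool} {p g : ArtinGroup Γ} (h : Pre (letter Γ x * p) g)
    (hx : ¬Starts Γ (flip x) p) : Pre p ((letter Γ x)⁻¹ * g) := by
  have h1 := h.starts (starts_letter_mul hx)
  have h2 := len_letter_mul hx
  rw [Pre, mul_inv_rev] at h
  rw [Starts] at h1
  rw [Pre, ← mul_assoc]
  omega

theorem pre_letter_mul {x : V × Bool} {p g : ArtinGroup Γ} (hx : Starts Γ x g)
    (h : Pre p ((letter Γ x)⁻¹ * g)) : Pre (letter Γ x * p) g := by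
  have h1 := len_mul_le (letter Γ x) p
  have h2 := len_mul_le (letter Γ x * p) ((letter Γ x * p)⁻¹ * g)
  have h3 := len_letter (Γ := Γ) x
  rw [mul_inv_cancel_left] at h2
  rw [Starts] at hx
  rw [Pre, ← mul_assoc, ← mul_inv_rev] at h
  rw [Pre]
  omega

/-- `x` and the first letter of `l` both start `g` and are different, so they commute; remove that
letter and repeat. -/
theorem pre_of_starts {x : V × Bool} {l : List (V × Bool)} {g : ArtinGroup Γ}
    (hx : Starts Γ x g) (hl : Geo Γ l) (hp : Pre (word Γ l) g)
    (hxl : ¬Starts Γ x (word Γ l)) :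
    (∀ y ∈ l, Γ.Adj x.1 y.1) ∧ Pre (word Γ l) ((letter Γ x)⁻¹ * g) := by
  induction l generalizing g with
  | nil => exact ⟨by simp, pre_one _⟩
  | cons y l ih =>
    have hy := hp.starts hl.starts
    have hne : x ≠ y := fun h => hxl (h ▸ hl.starts)
    have hadj := hx.adj hy hne
    rw [word_cons] at hp hxl ⊢
    rw [starts_mul_iff hadj] at hxl
    have hx' : Starts Γ x ((letter Γ y)⁻¹ * g) := by
      rw [← letter_flip]; exact (starts_mul_iff (by simpa using hadj)).2 hx
    have hy' : Starts Γ y ((letter Γ x)⁻¹ * g) := by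
      rw [← letter_flip]; exact (starts_mul_iff (by simpa using hadj.symm)).2 hy
    obtain ⟨h1, h2⟩ := ih hx' hl.tail (hp.tail hl.not_starts) hxl
    refine ⟨by simpa using ⟨hadj, by simpa using h1⟩, pre_letter_mul hy' ?_⟩
    rwa [← mul_assoc, (letter_commute hadj).symm.inv_inv.eq, mul_assoc]

theorem pre_of_disjoint {l m : List (V × Bool)} {g : ArtinGroup Γ} (hl : Geo Γ l)
    (hm : Geo Γ m) (hlg : Pre (word Γ l) g) (hmg : Pre (word Γ m) g)
    (hd : ∀ x, Starts Γ x (word Γ l) → ¬Starts Γ x (word Γ m)) :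
    (∀ x ∈ l, ∀ y ∈ m, Γ.Adj x.1 y.1) ∧ Pre (word Γ m) ((word Γ l)⁻¹ * g) := by
  induction l generalizing g with
  | nil => simpa using hmg
  | cons x l ih =>
    obtain ⟨h1, h2⟩ := pre_of_starts (hlg.starts hl.starts) hm hmg (hd x hl.starts)
    rw [word_cons] at hlg
    -- Disjointness of first letters survives the removal of `x`, since `x` commutes with every
    -- letter of `m`.
    obtain ⟨h3, h4⟩ := ih hl.tail (hlg.tail hl.not_starts) h2 (by
      intro z hz hz'
      refine hd z ?_ hz'
      rw [word_cons]
      exact (starts_mul_iff (h1 z (hz'.mem hm)).symm).2 hz)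
    refine ⟨?_, ?_⟩
    · intro z hz
      rcases List.mem_cons.1 hz with rfl | hz
      · exact h1
      · exact h3 z hz
    · rwa [word_cons, mul_inv_rev, mul_assoc]

theorem exists_common_prefix (a b : ArtinGroup Γ) : ∃ q, Pre q a ∧ Pre q b ∧
    ∀ x, Starts Γ x (q⁻¹ * a) → ¬Starts Γ x (q⁻¹ * b) := by
  induction hn : len a using Nat.strong_induction_on generalizing a b with
  | _ n ih =>
    by_cases hc : ∃ x, Starts Γ x a ∧ Starts Γ x b
    · obtain ⟨x, ha, hb⟩ := hc
      obtain ⟨q, h1, h2, h3⟩ := ih (len ((letter Γ x)⁻¹ * a)) (by rw [Starts] at ha; omega)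
        ((letter Γ x)⁻¹ * a) ((letter Γ x)⁻¹ * b) rfl
      refine ⟨letter Γ x * q, pre_letter_mul ha h1, pre_letter_mul hb h2, ?_⟩
      simpa [mul_assoc] using h3
    · refine ⟨1, pre_one _, pre_one _, ?_⟩
      push Not at hc
      simpa using hc

theorem Pre.trans_tail {q p g : ArtinGroup Γ} (h1 : Pre q p) (h2 : Pre p g) :
    Pre (q⁻¹ * p) (q⁻¹ * g) := by
  have e : (q⁻¹ * p)⁻¹ * (q⁻¹ * g) = p⁻¹ * g := by group
  have h3 := len_mul_le q (q⁻¹ * g)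
  have h4 := len_mul_le (q⁻¹ * p) (p⁻¹ * g)
  rw [mul_inv_cancel_left] at h3
  rw [mul_assoc, mul_inv_cancel_left] at h4
  rw [Pre] at *
  rw [e]
  omega

/-- Divide by a maximal common prefix. If both remainders were nontrivial, each would contain a
letter on `v`, yet by `pre_of_disjoint` their letters would commute pairwise with distinct vertices.
Thus such prefixes are linearly ordered and are determined by their length. -/
theorem pre_or_pre {a b g : ArtinGroup Γ} {v : V} (ha : Pre a g) (hb : Pre b g)
    (hav : ∀ x, Ends Γ x a → x.1 = v) (hbv : ∀ x, Ends Γ x b → x.1 = v) :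
    Pre a b ∨ Pre b a := by
  obtain ⟨q, hqa, hqb, hd⟩ := exists_common_prefix a b
  by_cases h1 : q⁻¹ * a = 1
  · left
    rwa [inv_mul_eq_one.1 h1] at hqb
  by_cases h2 : q⁻¹ * b = 1
  · right
    rwa [inv_mul_eq_one.1 h2] at hqa
  exfalso
  have key : ∀ c, (∀ x, Ends Γ x c → x.1 = v) → Pre q c → q⁻¹ * c ≠ 1 →
      ∃ l, word Γ l = q⁻¹ * c ∧ Geo Γ l ∧ ∃ x ∈ l, x.1 = v := by
    intro c hc hqc hne
    obtain ⟨l, hl, hlen⟩ := exists_geodesic_word (q⁻¹ * c)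
    obtain ⟨x, hx⟩ := exists_ends hne
    have hgeo : Geo Γ l := by rw [Geo, hl, hlen]
    refine ⟨l, hl, hgeo, x, Ends.mem (by rwa [hl]) hgeo, hc x ?_⟩
    have := hqc.red.ends hx
    rwa [mul_inv_cancel_left] at this
  obtain ⟨l, hl, hlg, x, hxl, hxv⟩ := key a hav hqa h1
  obtain ⟨m, hm, hmg, y, hym, hyv⟩ := key b hbv hqb h2
  have := (pre_of_disjoint (g := q⁻¹ * g) hlg hmg (by rw [hl]; exact hqa.trans_tail ha)
    (by rw [hm]; exact hqb.trans_tail hb) (by rw [hl, hm]; exact hd)).1 x hxl y hym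
  rw [hxv, hyv] at this
  exact this.ne rfl

theorem Pre.eq_of_len {a b : ArtinGroup Γ} (h : Pre a b) (hl : len a = len b) : a = b := by
  rw [Pre] at h
  exact inv_mul_eq_one.1 (len_eq_zero.1 (by omega))

end Prefixes

/-! ### Powers of a generator inside geodesic words -/

section Powers

variable {V : Type*} {Γ : SimpleGraph V}

variable (Γ) in
/-- The exponent sum. -/
def expSum : ArtinGroup Γ →* Multiplicative ℤ :=
  lift (fun _ => Multiplicative.ofAdd 1) fun _ _ _ => Commute.all _ _

/-- The exponent sum gives a lower bound for the length, which proves positive words geodesic. -/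
theorem natAbs_expSum_le (g : ArtinGroup Γ) : (expSum Γ g).toAdd.natAbs ≤ len g := by
  induction g using geodesic_induction with
  | h1 => simp
  | hm x g hx ih =>
    rw [len_letter_mul hx, map_mul, toAdd_mul]
    have : (expSum Γ (letter Γ x)).toAdd.natAbs ≤ 1 := by
      obtain ⟨v, _ | _⟩ := x <;> simp [letter, expSum]
    omega

theorem expSum_gen (v : V) : expSum Γ (gen Γ v) = Multiplicative.ofAdd 1 := lift_gen _ _ v

theorem len_gen_zpow (v : V) (k : ℤ) : len (gen Γ v ^ k) = k.natAbs := by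
  apply le_antisymm
  · have key : ∀ n : ℕ, len (gen Γ v ^ n) ≤ n := by
      intro n
      have := len_word_le (Γ := Γ) (List.replicate n (v, true))
      simpa [word, letter_true] using this
    obtain ⟨n, rfl | rfl⟩ := k.eq_nat_or_neg
    · simpa using key n
    · simpa using key n
  · simpa [expSum_gen] using natAbs_expSum_le (gen Γ v ^ k)

theorem len_gen_pow (v : V) (k : ℕ) : len (gen Γ v ^ k) = k := by
  simpa using len_gen_zpow (Γ := Γ) v k

/-- `g` has a geodesic word with a subword `v ^ k`. -/
def HasPow (v : V) (k : ℤ) (g : ArtinGroup Γ) : Prop :=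
  ∃ a b, g = a * gen Γ v ^ k * b ∧ len g = len a + k.natAbs + len b

theorem HasPow.mul_left {v : V} {k : ℤ} {a b : ArtinGroup Γ} (h : HasPow v k b) (hr : Red a b) :
    HasPow v k (a * b) := by
  obtain ⟨c, d, rfl, hl⟩ := h
  refine ⟨a * c, d, by group, ?_⟩
  have h1 := len_mul_le (a * c) (gen Γ v ^ k * d)
  have h2 := len_mul_le a c
  have h3 := len_mul_le (gen Γ v ^ k) d
  rw [len_gen_zpow] at h3
  rw [Red] at hr
  rw [show a * (c * gen Γ v ^ k * d) = a * c * (gen Γ v ^ k * d) by group] at *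
  omega

theorem HasPow.mul_right {v : V} {k : ℤ} {a b : ArtinGroup Γ} (h : HasPow v k a) (hr : Red a b) :
    HasPow v k (a * b) := by
  obtain ⟨c, d, rfl, hl⟩ := h
  refine ⟨c, d * b, by group, ?_⟩
  have h1 := len_mul_le (c * gen Γ v ^ k) (d * b)
  have h2 := len_mul_le c (gen Γ v ^ k)
  have h3 := len_mul_le d b
  rw [len_gen_zpow] at h2
  rw [Red] at hr
  rw [show c * gen Γ v ^ k * d * b = c * gen Γ v ^ k * (d * b) by group] at *
  omega

/-- Cut the power `v ^ k` into two powers of the same sign; the sign of `k` decides which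
alternative holds. -/
theorem HasPow.mono {v : V} {k : ℤ} {n : ℕ} {g : ArtinGroup Γ} (h : HasPow v k g)
    (hn : n ≤ k.natAbs) : HasPow v n g ∨ HasPow v (-n) g := by
  obtain ⟨a, b, rfl, hl⟩ := h
  have key : ∀ m : ℤ, m.natAbs + (k - m).natAbs = k.natAbs →
      HasPow v m (a * gen Γ v ^ k * b) := by
    intro m hm
    have e : a * gen Γ v ^ k * b = a * gen Γ v ^ m * (gen Γ v ^ (k - m) * b) := by
      rw [mul_assoc a (gen Γ v ^ m), ← mul_assoc (gen Γ v ^ m), ← zpow_add, add_sub_cancel, mul_assoc]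
    refine ⟨a, gen Γ v ^ (k - m) * b, e, ?_⟩
    have h1 := len_mul_le (gen Γ v ^ (k - m)) b
    have h2 := len_mul_le (a * gen Γ v ^ m) (gen Γ v ^ (k - m) * b)
    have h3 := len_mul_le a (gen Γ v ^ m)
    rw [len_gen_zpow] at h1 h3
    rw [e] at hl ⊢
    omega
  rcases le_total 0 k with hk | hk
  · exact Or.inl (key n (by omega))
  · exact Or.inr (key (-n) (by omega))

theorem word_replicate (v : V) (k : ℕ) :
    word Γ (List.replicate k (v, true)) = gen Γ v ^ k := by simp [word, letter_true]

theorem eq_of_starts_pow {v : V} {k : ℕ} {x : V × Bool} (h : Starts Γ x (gen Γ v ^ k)) :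
    x = (v, true) := by
  rw [← word_replicate] at h
  refine List.eq_of_mem_replicate (h.mem ?_)
  rw [Geo, word_replicate, len_gen_pow, List.length_replicate]

theorem ends_mul_pow_iff {x : V × Bool} {v : V} (h : Γ.Adj x.1 v) (g : ArtinGroup Γ) (k : ℕ) :
    Ends Γ x (g * gen Γ v ^ k) ↔ Ends Γ x g := by
  induction k with
  | zero => simp
  | succ k ih => rw [pow_succ, ← mul_assoc, ← letter_true, ends_mul_iff h, letter_true, ih]

theorem red_pow {v : V} {g : ArtinGroup Γ} (h : ¬Ends Γ (v, false) g) (k : ℕ) :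
    Red g (gen Γ v ^ k) := by
  refine red_of_not_ends fun x hx hs => h ?_
  have := congrArg flip (eq_of_starts_pow hs)
  rw [flip_flip] at this
  rw [this] at hx
  exact hx

/-- A reduced product `g v ^ (k + 1)`, where no letter at the end of `g` commutes with `v`, ends
only in `v`. -/
theorem eq_of_ends_mul_pow {v : V} {g : ArtinGroup Γ} (h : ¬Ends Γ (v, false) g)
    (hv : ∀ x, Ends Γ x g → ¬Γ.Adj x.1 v) {k : ℕ} {x : V × Bool}
    (hx : Ends Γ x (g * gen Γ v ^ (k + 1))) : x = (v, true) := by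
  by_contra hne
  rw [pow_succ, ← mul_assoc, ← letter_true] at hx
  have hr : ¬Ends Γ (flip (v, true)) (g * gen Γ v ^ k) := by
    have h1 : Red (g * gen Γ v ^ k) (gen Γ v) := by
      have h2 := red_pow h k
      have h3 := red_pow h (k + 1)
      rw [Red, len_gen_pow] at *
      rw [mul_assoc, ← pow_succ, h2, h3]
      have := len_gen_pow (Γ := Γ) v 1
      rw [pow_one] at this
      omega
    intro he
    rw [Ends, flip_flip, Starts, letter_true, ← mul_inv_rev, len_inv, len_inv, h1] at he
    omega
  -- A last letter other than `v` commutes with `v`, so it slides back through the whole power to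
  -- the end of `g`, which `hv` forbids.
  obtain ⟨h1, h2⟩ := hx.of_mul hne hr
  exact hv x ((ends_mul_pow_iff h1 g k).1 h2) h1

theorem Ends.mul_inv {x : V × Bool} {g : ArtinGroup Γ} (h : Ends Γ x g) :
    len (g * (letter Γ x)⁻¹) + 1 = len g := by
  rw [Ends, Starts, letter_flip, inv_inv] at h
  rwa [← len_inv (g * (letter Γ x)⁻¹), mul_inv_rev, inv_inv, ← len_inv g]

/-- A suffix of `x v ^ k` is a power of `v` or ends in `v ^ k`. -/
theorem suffix_mul_pow {v : V} {x w s : ArtinGroup Γ} (h : ¬Ends Γ (v, false) x)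
    (hv : ∀ y, Ends Γ y x → ¬Γ.Adj y.1 v) {k : ℕ} (hr : Red w s)
    (he : w * s = x * gen Γ v ^ k) :
    (∃ j ≤ k, s = gen Γ v ^ j) ∨ ∃ t, s = t * gen Γ v ^ k ∧ len s = len t + k := by
  induction k generalizing s with
  | zero => exact Or.inr ⟨s, by simp⟩
  | succ k ih =>
    by_cases hs : s = 1
    · exact Or.inl ⟨0, by omega, by simpa using hs⟩
    obtain ⟨z, hz⟩ := exists_ends hs
    have hzv : z = (v, true) := by
      have := hr.ends hz
      rw [he] at this
      exact eq_of_ends_mul_pow h hv this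
    subst hzv
    have hl := hz.mul_inv
    rw [letter_true] at hl
    have hr' : Red w (s * (gen Γ v)⁻¹) := by
      have h1 := len_mul_le w (s * (gen Γ v)⁻¹)
      have h2 := len_mul_le (w * s * (gen Γ v)⁻¹) (gen Γ v)
      have h3 := len_gen_pow (Γ := Γ) v 1
      rw [pow_one] at h3
      rw [inv_mul_cancel_right] at h2
      rw [Red] at *
      rw [← mul_assoc] at *
      omega
    rcases ih hr' (by rw [← mul_assoc, he, pow_succ]; group) with ⟨j, hj, hs'⟩ | ⟨t, ht, hlt⟩
    · exact Or.inl ⟨j + 1, by omega, by rw [pow_succ, ← hs', inv_mul_cancel_right]⟩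
    · refine Or.inr ⟨t, ?_, by omega⟩
      rw [pow_succ, ← mul_assoc, ← ht, inv_mul_cancel_right]

end Powers

/-! ### Locks: controlling the first letters in an irreducible group -/

section Irreducible

variable {V : Type*} {Γ : SimpleGraph V}

/-- Neighbouring letters of the chain do not commute, so each one blocks the next. Only the last
letter can cancel against `h`, and a new first letter from behind must commute past the entire
chain. -/
theorem chain_mul {l : List (V × Bool)} {z : V × Bool} {h : ArtinGroup Γ}
    (hl : (l ++ [z]).IsChain fun x y => Γᶜ.Adj x.1 y.1) (hz : ¬Starts Γ (flip z) h) :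
    len (word Γ (l ++ [z]) * h) = l.length + 1 + len h ∧
      ∀ x, Starts Γ x (word Γ (l ++ [z]) * h) →
        (l ++ [z]).head? = some x ∨ ∀ y ∈ l ++ [z], Γ.Adj x.1 y.1 := by
  induction l with
  | nil =>
    simp only [List.nil_append, word_cons, word_nil, mul_one, List.length_nil]
    refine ⟨by rw [len_letter_mul hz]; omega, fun x hx => ?_⟩
    by_cases hxz : x = z
    · simp [hxz]
    · right
      simpa using (hx.of_mul hxz hz).1
  | cons y l ih =>
    obtain ⟨ih1, ih2⟩ := ih hl.tail
    obtain ⟨c, m, hcm⟩ : ∃ c m, l ++ [z] = c :: m := by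
      cases hh : l ++ [z] with
      | nil => simp at hh
      | cons c m => exact ⟨c, m, rfl⟩
    rw [List.cons_append, hcm] at hl
    have hyc : Γᶜ.Adj y.1 c.1 := (List.isChain_cons_cons.1 hl).1
    rw [SimpleGraph.compl_adj] at hyc
    have hny : ¬Starts Γ (flip y) (word Γ (l ++ [z]) * h) := by
      intro hs
      rcases ih2 _ hs with h1 | h1
      · rw [hcm, List.head?_cons, Option.some.injEq] at h1
        rw [h1] at hyc
        exact hyc.1 rfl
      · exact hyc.2 (h1 c (by simp [hcm]))
    simp only [List.cons_append, word_cons, mul_assoc, List.length_cons]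
    refine ⟨by rw [len_letter_mul hny, ih1]; omega, fun x hx => ?_⟩
    by_cases hxy : x = y
    · simp [hxy]
    · obtain ⟨hadj, hx'⟩ := hx.of_mul hxy hny
      rcases ih2 _ hx' with h1 | h1
      · rw [hcm, List.head?_cons, Option.some.injEq] at h1
        rw [h1] at hyc
        exact absurd hadj.symm hyc.2
      · right
        simpa using ⟨hadj, by simpa using h1⟩

theorem exists_covering_walk {G : SimpleGraph V} (hG : G.Preconnected) (u : V) (T : Finset V) :
    ∃ w, ∃ p : G.Walk u w, ∀ s ∈ T, s ∈ p.support := by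
  classical
  induction T using Finset.induction_on with
  | empty => exact ⟨u, .nil, by simp⟩
  | insert a T _ ih =>
    obtain ⟨w, p, hp⟩ := ih
    obtain ⟨q⟩ := hG w a
    refine ⟨a, p.append q, fun s hs => ?_⟩
    rw [SimpleGraph.Walk.mem_support_append_iff]
    rcases Finset.mem_insert.1 hs with rfl | hs
    · exact Or.inr q.end_mem_support
    · exact Or.inl (hp s hs)

/-- In an irreducible group every element can be multiplied on the left, without cancellation, by
one of two elements such that the product starts only in `u`. -/
theorem exists_lock [Finite V] (hΓ : Γᶜ.Preconnected) {u v : V} (huv : u ≠ v) :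
    ∃ (N : ℕ) (c : Bool → ArtinGroup Γ), (∀ e, len (c e) = N) ∧ ∀ h, ∃ e, Red (c e) h ∧
      ∀ x, Starts Γ x (c e * h) → x = (u, true) := by
  have := Fintype.ofFinite V
  obtain ⟨w, p, hp⟩ := exists_covering_walk hΓ u Finset.univ
  -- Since `u ≠ v`, the walk has at least two vertices: the first letter keeps its sign while the
  -- sign of the last remains free.
  obtain ⟨z, l, hz⟩ : ∃ z l, p.support = u :: l ++ [z] := by
    cases p with
    | nil => have := hp v (Finset.mem_univ _); simp at this; exact absurd this.symm huv
    | cons h q =>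
      refine ⟨w, q.support.dropLast, ?_⟩
      rw [SimpleGraph.Walk.support_cons, List.cons_append]
      congr 1
      have := List.dropLast_append_getLast q.support_ne_nil
      rw [q.getLast_support] at this
      exact this.symm
  have hchain := p.isChain_adj_support
  rw [hz] at hchain hp
  -- The walk visits every vertex, including that of `x`, and no vertex is adjacent to itself.
  have hcov : ∀ (e : Bool) (x : V × Bool),
      ¬∀ y ∈ ((u, true) :: l.map (·, true)) ++ [(z, e)], Γ.Adj x.1 y.1 := by
    intro e x hx
    obtain ⟨y, hy, hyx⟩ : ∃ y ∈ ((u, true) :: l.map (·, true)) ++ [(z, e)], y.1 = x.1 := by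
      have := hp x.1 (Finset.mem_univ _)
      simp only [List.cons_append, List.mem_cons, List.mem_append, List.mem_map,
        List.not_mem_nil, or_false] at this ⊢
      rcases this with h | h | h
      · exact ⟨_, Or.inl rfl, h.symm⟩
      · exact ⟨_, Or.inr (Or.inl ⟨_, h, rfl⟩), rfl⟩
      · exact ⟨_, Or.inr (Or.inr rfl), h.symm⟩
    exact (hx y hy).ne hyx.symm
  have hch : ∀ e : Bool, (((u, true) :: l.map (·, true)) ++ [(z, e)]).IsChain
      fun x y => Γᶜ.Adj x.1 y.1 := by
    intro e
    have e1 : (((u, true) :: l.map (·, true)) ++ [(z, e)]).map Prod.fst = u :: l ++ [z] := by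
      simp [Function.comp_def]
    rw [← e1, List.isChain_map] at hchain
    exact hchain
  have hc : ∀ e, len (word Γ (((u, true) :: l.map (·, true)) ++ [(z, e)])) = l.length + 2 := by
    intro e
    have := (chain_mul (h := 1) (hch e) (by simp [Starts])).1
    simpa using this
  refine ⟨l.length + 2, fun e => word Γ (((u, true) :: l.map (·, true)) ++ [(z, e)]), hc, ?_⟩
  intro h
  -- `h` cannot start with both `z` and its inverse, so one of the two signs avoids cancellation.
  obtain ⟨e, he⟩ : ∃ e, ¬Starts Γ (flip (z, e)) h := by
    by_cases hs : Starts Γ (z, false) h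
    · exact ⟨false, hs.not_flip⟩
    · exact ⟨true, hs⟩
  obtain ⟨h1, h2⟩ := chain_mul (hch e) he
  refine ⟨e, ?_, fun x hx => ?_⟩
  · rw [Red, hc, h1]; simp
  · rcases h2 x hx with h3 | h3
    · simpa using h3.symm
    · exact absurd h3 (hcov e x)

end Irreducible

/-! ### Sphere sizes and counting elements with or without a given power -/

section Counting

variable {V : Type*} {Γ : SimpleGraph V}

variable (Γ) in
/-- The number of elements of length `n`. -/
noncomputable def sph (n : ℕ) : ℕ := (sphere (stdGens Γ) n).ncard

theorem finite_sphere [Finite V] (n : ℕ) : (sphere (stdGens Γ) n).Finite := by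
  refine ((List.finite_length_eq (V × Bool) n).image (word Γ)).subset fun g hg => ?_
  obtain ⟨l, hl, hlen⟩ := exists_geodesic_word g
  exact ⟨l, hlen.trans hg, hl⟩

theorem ball_eq_biUnion (n : ℕ) :
    ball (stdGens Γ) n = ⋃ i ∈ Finset.range (n + 1), sphere (stdGens Γ) i := by
  ext g
  simp [ball, sphere]

theorem finite_ball [Finite V] (n : ℕ) : (ball (stdGens Γ) n).Finite := by
  rw [ball_eq_biUnion]
  exact Set.Finite.biUnion (Finset.finite_toSet _) fun i _ => finite_sphere i

theorem exists_pre (g : ArtinGroup Γ) {i : ℕ} (hi : i ≤ len g) : ∃ a, Pre a g ∧ len a = i := by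
  obtain ⟨l, rfl, hl⟩ := exists_geodesic_word g
  rw [← hl] at hi
  have h1 := len_word_le (Γ := Γ) (l.take i)
  have h2 := len_word_le (Γ := Γ) (l.drop i)
  have e : word Γ l = word Γ (l.take i) * word Γ (l.drop i) := by
    rw [← word_append, List.take_append_drop]
  have h3 := len_mul_le (word Γ (l.take i)) (word Γ (l.drop i))
  rw [← e] at h3
  rw [List.length_take, min_eq_left hi] at h1
  rw [List.length_drop] at h2
  refine ⟨word Γ (l.take i), ?_, by omega⟩
  rw [Pre, e, inv_mul_cancel_left, ← e]
  omega

/-- The letters on `u` on either side neither cancel with `v` nor commute with it, so the inserted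
power is held in place. -/
theorem red_mul_pow_mul {u v : V} (huv : u ≠ v) (hadj : ¬Γ.Adj u v) {x h : ArtinGroup Γ}
    (hx : ∀ y, Ends Γ y x → y = (u, false)) (hh : ∀ y, Starts Γ y h → y = (u, true)) {k : ℕ}
    (hk : 1 ≤ k) : Red x (gen Γ v ^ k) ∧ Red (x * gen Γ v ^ k) h ∧
      ∀ y, Ends Γ y (x * gen Γ v ^ k) → y = (v, true) := by
  have h1 : ¬Ends Γ (v, false) x := fun he => huv (congrArg Prod.fst (hx _ he)).symm
  have h2 : ∀ y, Ends Γ y (x * gen Γ v ^ k) → y = (v, true) := by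
    intro y hy
    obtain ⟨k, rfl⟩ : ∃ m, k = m + 1 := ⟨k - 1, by omega⟩
    refine eq_of_ends_mul_pow h1 (fun z hz => ?_) hy
    rw [hx z hz]
    exact hadj
  refine ⟨red_pow h1 k, red_of_not_ends fun y hy hs => ?_, h2⟩
  have := hh _ hs
  rw [h2 y hy] at this
  exact huv (congrArg Prod.fst this).symm

/-- A locked prefix of `g` of the form `x v ^ k` is determined, given the shortest one, by a
bounded amount of information, when the rest of `g` does not have a power `v ^ k`. -/
theorem exists_eq_mul_pow {v : V} {k : ℕ} {g p₁ x₂ c b : ArtinGroup Γ}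
    (h₁ : ∀ y, Ends Γ y p₁ → y.1 = v) (h₂ : ∀ y, Ends Γ y (x₂ * gen Γ v ^ k) → y.1 = v)
    (hx₂ : ∀ y, Ends Γ y x₂ → y.1 ≠ v ∧ ¬Γ.Adj y.1 v)
    (hp₁ : Pre p₁ g) (hp₂ : Pre (x₂ * gen Γ v ^ k) g) (hle : len p₁ ≤ len (x₂ * gen Γ v ^ k))
    (hg : g = p₁ * (c * b)) (hcb : Red c b) (hb : ¬HasPow v k b) :
    ∃ q, len q ≤ len c ∧ ∃ j ≤ k, x₂ * gen Γ v ^ k = p₁ * q * gen Γ v ^ j := by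
  have hpre : Pre p₁ (x₂ * gen Γ v ^ k) := by
    rcases pre_or_pre hp₁ hp₂ h₁ h₂ with h | h
    · exact h
    · have : len p₁ = len (x₂ * gen Γ v ^ k) := by
        rw [Pre] at h
        omega
      rw [h.eq_of_len this.symm]
      exact pre_refl _
  obtain ⟨r, hr⟩ : ∃ r, r = p₁⁻¹ * (x₂ * gen Γ v ^ k) := ⟨_, rfl⟩
  have hrg : Pre r (c * b) := by
    have := hpre.trans_tail hp₂
    rwa [← hr, hg, inv_mul_cancel_left] at this
  -- `r` is what separates the two prefixes. Its part in common with `c` is short; the remainder is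
  -- disjoint from the rest of `c`, commutes past it, and hence is a prefix of `b`.
  obtain ⟨q, hqc, hqr, hd⟩ := exists_common_prefix c r
  obtain ⟨l, hl, hlen⟩ := exists_geodesic_word (q⁻¹ * c)
  obtain ⟨m, hm, hmen⟩ := exists_geodesic_word (q⁻¹ * r)
  have hprefix := (pre_of_disjoint (l := l) (m := m) (g := q⁻¹ * (c * b)) (by rw [Geo, hl, hlen])
    (by rw [Geo, hm, hmen]) (by rw [hl]; exact hqc.trans_tail hcb.pre)
    (by rw [hm]; exact hqr.trans_tail hrg) (by rw [hl, hm]; exact hd)).2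
  have e1 : (q⁻¹ * c)⁻¹ * (q⁻¹ * (c * b)) = b := by group
  rw [hl, hm, e1] at hprefix
  have hq : len q ≤ len c := by rw [Pre] at hqc; omega
  have hp₁r : p₁ * r = x₂ * gen Γ v ^ k := by rw [hr, mul_inv_cancel_left]
  have hred : Red (p₁ * q) (q⁻¹ * r) := by
    refine hqr.red.assoc_left ?_
    rw [mul_inv_cancel_left, hr]
    exact hpre.red
  have he : p₁ * q * (q⁻¹ * r) = x₂ * gen Γ v ^ k := by
    rw [mul_assoc, mul_inv_cancel_left, hp₁r]
  refine ⟨q, hq, ?_⟩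
  -- The remainder is a suffix of `x₂ v ^ k`: either it is a power of `v`, or it contains all of `v
  -- ^ k`, which would then occur in `b`.
  rcases suffix_mul_pow (fun h => (hx₂ _ h).1 rfl) (fun y hy => (hx₂ y hy).2) hred he with
    ⟨j, hj, hj'⟩ | ⟨t, ht, htl⟩
  · exact ⟨j, hj, by rw [← hj', he]⟩
  · exfalso
    refine hb ?_
    have h3 : HasPow v k (q⁻¹ * r) := ⟨t, 1, by simpa using ht, by simpa using htl⟩
    have := h3.mul_right hprefix.red
    rwa [mul_inv_cancel_left] at this

theorem ends_only_of_lock {u : V} {a c : ArtinGroup Γ}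
    (h : ∀ x, Starts Γ x (c * a⁻¹) → x = (u, true)) :
    ∀ y, Ends Γ y (a * c⁻¹) → y = (u, false) := by
  intro y hy
  rw [Ends, mul_inv_rev, inv_inv] at hy
  have := congrArg flip (h _ hy)
  rwa [flip_flip] at this

theorem red_of_lock {a c : ArtinGroup Γ} (h : Red c a⁻¹) : Red a c⁻¹ := by
  simpa using h.symm

/-- Supermultiplicativity of the sphere sizes of an irreducible group, up to a shift. -/
theorem exists_sph_mul_le [Finite V] (hΓ : Γᶜ.Preconnected) {u v : V} (huv : u ≠ v)
    (hadj : ¬Γ.Adj u v) :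
    ∃ N, ∀ m n, sph Γ m * sph Γ n ≤ 4 * sph Γ (m + n + N) := by
  obtain ⟨N, c, hc, hlock⟩ := exists_lock hΓ huv
  choose e he using hlock
  -- Two locks and a single letter `v` are inserted; the factor 4 counts the pairs of lock signs.
  refine ⟨2 * N + 1, fun m n => ?_⟩
  have h4 : 4 = (Set.univ : Set (Bool × Bool)).ncard := by
    rw [Set.ncard_univ]; simp
  rw [h4, sph, sph, sph, ← Set.ncard_prod, ← Set.ncard_prod]
  refine Set.ncard_le_ncard_of_injOn (fun p => ((e p.1⁻¹, e p.2),
    p.1 * (c (e p.1⁻¹))⁻¹ * gen Γ v ^ 1 * (c (e p.2) * p.2))) ?_ ?_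
    (Set.finite_univ.prod (finite_sphere _))
  · rintro ⟨a, b⟩ ⟨ha, hb⟩
    refine ⟨Set.mem_univ _, ?_⟩
    obtain ⟨h1, h2, -⟩ := red_mul_pow_mul huv hadj (ends_only_of_lock (he a⁻¹).2) (he b).2 le_rfl
    have h3 := red_of_lock (he a⁻¹).1
    have h5 := (he b).1
    have ha' : len a = m := ha
    have hb' : len b = n := hb
    change len _ = _
    rw [Red, len_gen_pow] at *
    dsimp only
    rw [h2, h1, h3, h5, len_inv, hc, hc]
    omega
  · rintro ⟨a, b⟩ ⟨ha, hb⟩ ⟨a', b'⟩ ⟨ha', hb'⟩ heq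
    simp only [Prod.mk.injEq] at heq
    obtain ⟨⟨e1, e2⟩, e3⟩ := heq
    have ha1 : len a = m := ha
    have ha2 : len a' = m := ha'
    obtain ⟨h1, h2, h3⟩ := red_mul_pow_mul huv hadj (ends_only_of_lock (he a⁻¹).2) (he b).2 le_rfl
    obtain ⟨h1', h2', h3'⟩ :=
      red_mul_pow_mul huv hadj (ends_only_of_lock (he a'⁻¹).2) (he b').2 le_rfl
    have h4 := red_of_lock (he a⁻¹).1
    have h4' := red_of_lock (he a'⁻¹).1
    have hl : len (a * (c (e a⁻¹))⁻¹ * gen Γ v ^ 1) = len (a' * (c (e a'⁻¹))⁻¹ * gen Γ v ^ 1) := by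
      rw [h1, h1', h4, h4', ha1, ha2, len_inv, len_inv, hc, hc]
    have hp := h2.pre
    have hp' := h2'.pre
    rw [← e3] at hp'
    -- Both prefixes end only in `v`, so they are nested; having equal length, they coincide.
    have hpp : a * (c (e a⁻¹))⁻¹ * gen Γ v ^ 1 = a' * (c (e a'⁻¹))⁻¹ * gen Γ v ^ 1 := by
      rcases pre_or_pre (v := v) hp hp' (fun y hy => by rw [h3 y hy])
        (fun y hy => by rw [h3' y hy]) with h | h
      · exact h.eq_of_len hl
      · exact (h.eq_of_len hl.symm).symm
    rw [hpp, e2] at e3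
    rw [e1] at hpp
    have hb3 := mul_left_cancel (mul_left_cancel e3)
    have ha3 := mul_right_cancel (mul_right_cancel hpp)
    rw [ha3, hb3]

/-- Inserting `v ^ k` at all the places of the elements without such a power shows that these
elements are rare. -/
theorem exists_count_not_hasPow_le [Finite V] (hΓ : Γᶜ.Preconnected) {u v : V} (huv : u ≠ v)
    (hadj : ¬Γ.Adj u v) :
    ∃ C N : ℕ, ∀ m k : ℕ, 1 ≤ k → (m + 1) * (sphere (stdGens Γ) m ∩ {g | ¬HasPow v k g}).ncard ≤
      C * (k + 1) * sph Γ (m + k + N) := by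
  classical
  obtain ⟨N, c, hc, hlock⟩ := exists_lock hΓ huv
  choose e he using hlock
  -- The ball bounds the choices of `q` in `exists_eq_mul_pow`, 4 the sign pairs, and `2 * N` is the
  -- length of the two locks.
  refine ⟨(ball (stdGens Γ) N).ncard * 4, 2 * N, fun m k hk => ?_⟩
  have hfin : (sphere (stdGens Γ) m ∩ {g | ¬HasPow v k g}).Finite :=
    (finite_sphere m).subset Set.inter_subset_left
  have hdec : ∀ (g : ArtinGroup Γ) (i : ℕ), ∃ a, i ≤ len g → Pre a g ∧ len a = i := by
    intro g i
    by_cases hi : i ≤ len g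
    · obtain ⟨a, ha⟩ := exists_pre g hi
      exact ⟨a, fun _ => ha⟩
    · exact ⟨1, fun h => absurd h hi⟩
  choose a ha using hdec
  set x : ArtinGroup Γ → ℕ → ArtinGroup Γ := fun g i => a g i * (c (e (a g i)⁻¹))⁻¹ with hx
  set y : ArtinGroup Γ → ℕ → ArtinGroup Γ :=
    fun g i => c (e ((a g i)⁻¹ * g)) * ((a g i)⁻¹ * g) with hy
  -- Cut `p.1` at position `p.2` and insert the locked power, recording the signs of the locks.
  set F : ArtinGroup Γ × ℕ → (Bool × Bool) × ArtinGroup Γ := fun p =>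
    ((e (a p.1 p.2)⁻¹, e ((a p.1 p.2)⁻¹ * p.1)), x p.1 p.2 * gen Γ v ^ k * y p.1 p.2) with hF
  set S : Finset (ArtinGroup Γ × ℕ) := hfin.toFinset ×ˢ Finset.range (m + 1) with hS
  have hSm : ∀ p ∈ S, len p.1 = m ∧ ¬HasPow v k p.1 ∧ p.2 ≤ m := by
    intro p hp
    rw [hS, Finset.mem_product, Set.Finite.mem_toFinset, Finset.mem_range] at hp
    exact ⟨hp.1.1, hp.1.2, by omega⟩
  have hglue : ∀ p ∈ S, Red (x p.1 p.2) (gen Γ v ^ k) ∧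
      Red (x p.1 p.2 * gen Γ v ^ k) (y p.1 p.2) ∧
      ∀ z, Ends Γ z (x p.1 p.2 * gen Γ v ^ k) → z = (v, true) := fun p _ =>
    red_mul_pow_mul huv hadj (ends_only_of_lock (he _).2) (he _).2 hk
  have hends : ∀ p : ArtinGroup Γ × ℕ, ∀ z, Ends Γ z (x p.1 p.2) → z = (u, false) := fun p =>
    ends_only_of_lock (he _).2
  have hcard : S.card = (m + 1) * (sphere (stdGens Γ) m ∩ {g | ¬HasPow v k g}).ncard := by
    rw [hS, Finset.card_product, Finset.card_range, ← Set.ncard_eq_toFinset_card _ hfin, mul_comm]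
  set B : Finset (ArtinGroup Γ) := (finite_ball (Γ := Γ) N).toFinset with hB
  have hBcard : B.card = (ball (stdGens Γ) N).ncard := (Set.ncard_eq_toFinset_card _ _).symm
  have himage : (S.image F).card ≤ 4 * sph Γ (m + k + 2 * N) := by
    have hsub : S.image F ⊆
        Finset.univ ×ˢ (finite_sphere (Γ := Γ) (m + k + 2 * N)).toFinset := by
      intro z hz
      obtain ⟨p, hp, rfl⟩ := Finset.mem_image.1 hz
      rw [Finset.mem_product]
      refine ⟨Finset.mem_univ _, ?_⟩
      rw [Set.Finite.mem_toFinset]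
      obtain ⟨h1, h2, -⟩ := hglue p hp
      obtain ⟨h3, h4, h5⟩ := hSm p hp
      obtain ⟨h6, h7⟩ := ha p.1 p.2 (by omega)
      have h8 := red_of_lock (he (a p.1 p.2)⁻¹).1
      have h9 := (he ((a p.1 p.2)⁻¹ * p.1)).1
      change len (x p.1 p.2 * gen Γ v ^ k * y p.1 p.2) = _
      rw [Red, len_gen_pow] at *
      rw [h2, h1]
      simp only [hx, hy]
      rw [h8, h9, len_inv, hc, hc]
      rw [Pre] at h6
      omega
    refine (Finset.card_le_card hsub).trans ?_
    rw [Finset.card_product, sph, Set.ncard_eq_toFinset_card _ (finite_sphere _)]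
    simp
  have hfib : ∀ z ∈ S.image F, (S.filter fun p => F p = z).card ≤ B.card * (k + 1) := by
    intro z hz
    have hne : (S.filter fun p => F p = z).Nonempty := by
      obtain ⟨p, hp, rfl⟩ := Finset.mem_image.1 hz
      exact ⟨p, by simp [hp]⟩
    -- All prefixes occurring in the fibre are compared with the shortest one.
    obtain ⟨p₁, hp₁, hmin⟩ := Finset.exists_min_image _
      (fun p => len (x p.1 p.2 * gen Γ v ^ k)) hne
    rw [Finset.mem_filter] at hp₁
    have hsub : (S.filter fun p => F p = z).image (fun p => x p.1 p.2 * gen Γ v ^ k) ⊆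
        (B ×ˢ Finset.range (k + 1)).image
          fun q => x p₁.1 p₁.2 * gen Γ v ^ k * q.1 * gen Γ v ^ q.2 := by
      intro w hw
      obtain ⟨p, hp, rfl⟩ := Finset.mem_image.1 hw
      have hm := hmin p hp
      rw [Finset.mem_filter] at hp
      obtain ⟨h1, h2, h3⟩ := hglue p hp.1
      obtain ⟨h1', h2', h3'⟩ := hglue p₁ hp₁.1
      obtain ⟨h4, h5, h6⟩ := hSm p₁ hp₁.1
      obtain ⟨h7, h8⟩ := ha p₁.1 p₁.2 (by omega)
      have hzz : x p₁.1 p₁.2 * gen Γ v ^ k * y p₁.1 p₁.2 =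
          x p.1 p.2 * gen Γ v ^ k * y p.1 p.2 :=
        congrArg Prod.snd (hp₁.2.trans hp.2.symm)
      have hb : ¬HasPow v k ((a p₁.1 p₁.2)⁻¹ * p₁.1) := by
        intro hh
        have := hh.mul_left h7.red
        rw [mul_inv_cancel_left] at this
        exact h5 this
      obtain ⟨q, hq, j, hj, hqj⟩ := exists_eq_mul_pow (fun z hz => by rw [h3' z hz])
        (fun z hz => by rw [h3 z hz])
        (fun z hz => by rw [hends p z hz]; exact ⟨huv, hadj⟩) h2'.pre
        (by rw [hzz]; exact h2.pre) hm rfl (he _).1 hb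
      rw [Finset.mem_image]
      refine ⟨(q, j), ?_, hqj.symm⟩
      rw [Finset.mem_product, hB, Set.Finite.mem_toFinset, Finset.mem_range]
      exact ⟨hq.trans (hc _).le, by simpa using Nat.lt_succ_of_le hj⟩
    -- Within a fibre the locks are known, so the prefix gives back the cut, its position and the
    -- original element.
    have hinj : Set.InjOn (fun p : ArtinGroup Γ × ℕ => x p.1 p.2 * gen Γ v ^ k)
        ((S.filter fun p => F p = z : Finset _) : Set (ArtinGroup Γ × ℕ)) := by
      intro p hp p' hp' hpp
      rw [Finset.mem_coe, Finset.mem_filter] at hp hp'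
      have hFF := hp.2.trans hp'.2.symm
      simp only [hF, Prod.mk.injEq] at hFF
      obtain ⟨⟨e1, e2⟩, e3⟩ := hFF
      dsimp only at hpp
      rw [hpp] at e3
      have e4 := mul_left_cancel e3
      simp only [hy] at e4
      rw [e2] at e4
      have e5 := mul_left_cancel e4
      simp only [hx] at hpp
      rw [e1] at hpp
      have e6 := mul_right_cancel (mul_right_cancel hpp)
      obtain ⟨h4, h5, h6⟩ := hSm p hp.1
      obtain ⟨h4', h5', h6'⟩ := hSm p' hp'.1
      have h8 := (ha p.1 p.2 (by omega)).2
      have h8' := (ha p'.1 p'.2 (by omega)).2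
      rw [e6] at e5
      refine Prod.ext (mul_left_cancel e5) ?_
      rw [← h8, ← h8', e6]
    calc _ = _ := (Finset.card_image_of_injOn hinj).symm
      _ ≤ _ := Finset.card_le_card hsub
      _ ≤ _ := Finset.card_image_le
      _ = _ := by rw [Finset.card_product, Finset.card_range]
  have := Finset.card_le_mul_card_image S _ hfib
  rw [hcard, hBcard] at this
  calc _ ≤ _ := this
    _ ≤ _ := Nat.mul_le_mul_left _ himage
    _ = _ := by ring

theorem sph_add_le [Finite V] (m n : ℕ) : sph Γ (m + n) ≤ sph Γ m * sph Γ n := by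
  rw [sph, sph, sph, ← Set.ncard_prod]
  refine (Set.ncard_le_ncard (t := (fun p : ArtinGroup Γ × ArtinGroup Γ => p.1 * p.2) ''
    (sphere (stdGens Γ) m ×ˢ sphere (stdGens Γ) n)) ?_ ?_).trans (Set.ncard_image_le ?_)
  · intro g hg
    have hg' : len g = m + n := hg
    obtain ⟨a, ha, hl⟩ := exists_pre g (i := m) (by omega)
    refine ⟨(a, a⁻¹ * g), ⟨hl, ?_⟩, by simp⟩
    change len _ = n
    rw [Pre] at ha
    dsimp only
    omega
  · exact ((finite_sphere m).prod (finite_sphere n)).image _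
  · exact (finite_sphere m).prod (finite_sphere n)

theorem sph_pos [Finite V] [Nonempty V] (n : ℕ) : 0 < sph Γ n := by
  obtain ⟨v⟩ := ‹Nonempty V›
  rw [sph, Set.ncard_pos (finite_sphere n)]
  exact ⟨gen Γ v ^ n, len_gen_pow v n⟩

theorem sph_zero : sph Γ 0 = 1 := by
  have : sphere (stdGens Γ) 0 = {1} := by
    ext g
    exact len_eq_zero
  rw [sph, this, Set.ncard_singleton]

theorem sph_le_two [Subsingleton V] (n : ℕ) : sph Γ n ≤ 2 := by
  rcases isEmpty_or_nonempty V with hV | ⟨⟨v⟩⟩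
  · have : ∀ g : ArtinGroup Γ, g = 1 := by
      intro g
      obtain ⟨l, rfl⟩ := exists_word g
      cases l with
      | nil => rfl
      | cons x _ => exact hV.elim x.1
    refine (Set.ncard_le_ncard (t := {1}) (fun g _ => this g)).trans ?_
    simp
  · have : ∀ g : ArtinGroup Γ, ∃ k : ℤ, g = gen Γ v ^ k := by
      intro g
      induction g using letter_induction with
      | h1 => exact ⟨0, by simp⟩
      | hm x g ih =>
        obtain ⟨k, rfl⟩ := ih
        obtain ⟨w, _ | _⟩ := x
        · exact ⟨-1 + k, by rw [zpow_add, Subsingleton.elim w v]; simp [letter]⟩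
        · exact ⟨1 + k, by rw [zpow_add, Subsingleton.elim w v]; simp [letter]⟩
    refine (Set.ncard_le_ncard (t := {gen Γ v ^ (n : ℤ), gen Γ v ^ (-n : ℤ)}) (fun g hg => ?_)
      (by simp)).trans ((Set.ncard_insert_le _ _).trans (by simp))
    obtain ⟨k, rfl⟩ := this g
    have hk : k.natAbs = n := (len_gen_zpow v k).symm.trans hg
    rcases Int.natAbs_eq k with h | h
    · left; rw [h, hk]
    · right; rw [h, hk]; rfl

/-- The number of elements with a power `v ^ k`. -/
theorem count_hasPow_le [Finite V] (v : V) (m : ℕ) (k : ℤ) :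
    (sphere (stdGens Γ) m ∩ {g | HasPow v k g}).ncard ≤
      ∑ i ∈ Finset.range (m + 1), if i + k.natAbs ≤ m then sph Γ i * sph Γ (m - k.natAbs - i)
        else 0 := by
  classical
  set T : ℕ → Set (ArtinGroup Γ) := fun i => if i + k.natAbs ≤ m then
    (fun p : ArtinGroup Γ × ArtinGroup Γ => p.1 * gen Γ v ^ k * p.2) ''
      (sphere (stdGens Γ) i ×ˢ sphere (stdGens Γ) (m - k.natAbs - i)) else ∅ with hT
  have hTfin : ∀ i, (T i).Finite := by
    intro i
    simp only [hT]
    split_ifs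
    · exact ((finite_sphere _).prod (finite_sphere _)).image _
    · exact Set.finite_empty
  have hsub : sphere (stdGens Γ) m ∩ {g | HasPow v k g} ⊆ ⋃ i ∈ Finset.range (m + 1), T i := by
    rintro g ⟨hg, a, b, rfl, hl⟩
    have hg' : len (a * gen Γ v ^ k * b) = m := hg
    rw [Set.mem_iUnion₂]
    refine ⟨len a, Finset.mem_range.2 (by omega), ?_⟩
    simp only [hT]
    rw [if_pos (by omega)]
    refine ⟨(a, b), ⟨rfl, ?_⟩, rfl⟩
    change len b = _
    omega
  refine (Set.ncard_le_ncard hsub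
    (Set.Finite.biUnion (Finset.finite_toSet _) fun i _ => hTfin i)).trans ?_
  refine (Finset.set_ncard_biUnion_le _ _).trans (Finset.sum_le_sum fun i _ => ?_)
  simp only [hT]
  split_ifs
  · refine (Set.ncard_image_le ((finite_sphere _).prod (finite_sphere _))).trans ?_
    rw [Set.ncard_prod]
    rfl
  · simp

end Counting

/-! ### Growth rates of real sequences -/

section Sequences

/-- A submultiplicative sequence has a growth rate. -/
theorem exists_growth {u : ℕ → ℝ} (h1 : ∀ n, 1 ≤ u n) (hu : ∀ m n, u (m + n) ≤ u m * u n) :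
    ∃ L : ℝ, 1 ≤ L ∧ Tendsto (fun n : ℕ => u n ^ (1 / (n : ℝ))) atTop (𝓝 L) ∧
      ∀ n, L ^ n ≤ u n := by
  have hpos : ∀ n, 0 < u n := fun n => zero_lt_one.trans_le (h1 n)
  have hsub : Subadditive fun n => Real.log (u n) := by
    intro m n
    rw [← Real.log_mul (hpos m).ne' (hpos n).ne']
    exact Real.log_le_log (hpos _) (hu m n)
  have hbdd : BddBelow (Set.range fun n : ℕ => Real.log (u n) / n) := by
    refine ⟨0, ?_⟩
    rintro _ ⟨n, rfl⟩
    exact div_nonneg (Real.log_nonneg (h1 n)) (Nat.cast_nonneg n)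
  have ht : Tendsto (fun n : ℕ => u n ^ (1 / (n : ℝ))) atTop (𝓝 (Real.exp hsub.lim)) := by
    refine ((Real.continuous_exp.tendsto _).comp (hsub.tendsto_lim hbdd)).congr fun n => ?_
    rw [Function.comp_apply, Real.rpow_def_of_pos (hpos n), mul_one_div]
  refine ⟨Real.exp hsub.lim, ?_, ht, fun n => ?_⟩
  · exact ge_of_tendsto' ht fun n => Real.one_le_rpow (h1 n) (by positivity)
  · rcases eq_or_ne n 0 with rfl | hn
    · simpa using h1 0
    · have hn' : (0 : ℝ) < n := by positivity
      have := hsub.lim_le_div hbdd hn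
      rw [le_div_iff₀ hn'] at this
      rw [← Real.exp_nat_mul, ← Real.exp_log (hpos n)]
      exact Real.exp_le_exp.2 (by rw [mul_comm]; exact this)

theorem exists_le_mul_pow {u : ℕ → ℝ} {L μ : ℝ} (h0 : ∀ n, 0 ≤ u n)
    (hu : Tendsto (fun n : ℕ => u n ^ (1 / (n : ℝ))) atTop (𝓝 L)) (hL : L < μ) (hμ : 1 ≤ μ) :
    ∃ K : ℝ, 0 < K ∧ ∀ n, u n ≤ K * μ ^ n := by
  have hev : ∀ᶠ n : ℕ in atTop, u n ≤ μ ^ n := by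
    filter_upwards [hu.eventually_lt_const hL, eventually_gt_atTop 0] with n hn hn0
    have hn0' : (n : ℝ) ≠ 0 := by positivity
    have : u n = (u n ^ (1 / (n : ℝ))) ^ n := by
      rw [← Real.rpow_natCast, ← Real.rpow_mul (h0 n), one_div_mul_cancel hn0', Real.rpow_one]
    rw [this]
    exact pow_le_pow_left₀ (Real.rpow_nonneg (h0 n) _) hn.le n
  obtain ⟨n₀, hn₀⟩ := eventually_atTop.1 hev
  have hsum : 0 ≤ ∑ i ∈ Finset.range n₀, u i := Finset.sum_nonneg fun i _ => h0 i
  refine ⟨1 + ∑ i ∈ Finset.range n₀, u i, by positivity, fun n => ?_⟩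
  have hp : 1 ≤ μ ^ n := one_le_pow₀ hμ
  rcases lt_or_ge n n₀ with h | h
  · have := Finset.single_le_sum (f := u) (fun i _ => h0 i) (Finset.mem_range.2 h)
    nlinarith
  · have := hn₀ n h
    nlinarith

/-- A polynomial factor cannot compensate for a larger exponential rate. -/
theorem le_of_pow_le_mul_pow {a b K : ℝ} {d : ℕ} (hb : 0 < b)
    (h : ∀ n : ℕ, a ^ n ≤ K * ((n : ℝ) + 1) ^ d * b ^ n) : a ≤ b := by
  by_contra! hlt
  have hr : 1 < a / b := (one_lt_div hb).2 hlt
  have ht := (tendsto_pow_const_div_const_pow_of_one_lt d hr).comp (tendsto_add_atTop_nat 1)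
  have ht' := ht.const_mul (K * (a / b))
  rw [mul_zero] at ht'
  have : (1 : ℝ) ≤ 0 := by
    refine ge_of_tendsto' ht' fun n => ?_
    have h1 := h n
    have hbn : 0 < b ^ n := pow_pos hb n
    have han : 0 < (a / b) ^ n := pow_pos (by linarith) n
    rw [← div_le_iff₀ hbn, ← div_pow] at h1
    simp only [Function.comp_apply, Nat.cast_add, Nat.cast_one]
    rw [pow_succ (a / b), mul_div_assoc', le_div_iff₀ (by positivity)]
    nlinarith [mul_le_mul_of_nonneg_right h1 (by linarith : 0 ≤ a / b)]
  linarith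

end Sequences

/-! ### Growth rates of right-angled Artin groups -/

section Growth

variable {V : Type*} {Γ : SimpleGraph V}

theorem ncard_ball [Finite V] (n : ℕ) :
    (ball (stdGens Γ) n).ncard = ∑ i ∈ Finset.range (n + 1), sph Γ i := by
  induction n with
  | zero =>
    rw [ball_eq_biUnion]
    simp [sph]
  | succ n ih =>
    rw [Finset.sum_range_succ, ← ih, sph, ← Set.ncard_union_eq _ (finite_ball n) (finite_sphere _)]
    · congr 1
      ext g
      simp only [ball, sphere, Set.mem_ofPred_eq, Set.mem_union]
      omega
    · rw [Set.disjoint_left]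
      intro g h1 h2
      simp only [ball, sphere, Set.mem_ofPred_eq] at h1 h2
      omega

theorem ncard_ball_add_le [Finite V] (m n : ℕ) : (ball (stdGens Γ) (m + n)).ncard ≤
    (ball (stdGens Γ) m).ncard * (ball (stdGens Γ) n).ncard := by
  have hfin := (finite_ball (Γ := Γ) m).prod (finite_ball (Γ := Γ) n)
  rw [← Set.ncard_prod]
  refine (Set.ncard_le_ncard (t := (fun p : ArtinGroup Γ × ArtinGroup Γ => p.1 * p.2) ''
    (ball (stdGens Γ) m ×ˢ ball (stdGens Γ) n)) ?_ (hfin.image _)).trans (Set.ncard_image_le hfin)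
  intro g hg
  have hg' : len g ≤ m + n := hg
  obtain ⟨a, ha, hl⟩ := exists_pre g (i := min m (len g)) (by omega)
  have h1 : len a ≤ m := by omega
  have h2 : len (a⁻¹ * g) ≤ n := by
    rw [Pre] at ha
    omega
  exact ⟨(a, a⁻¹ * g), ⟨h1, h2⟩, by simp⟩

theorem one_le_ncard_ball [Finite V] (n : ℕ) : 1 ≤ (ball (stdGens Γ) n).ncard := by
  rw [Nat.one_le_iff_ne_zero, ← Nat.pos_iff_ne_zero, Set.ncard_pos (finite_ball n)]
  exact ⟨1, by simp only [ball, Set.mem_ofPred_eq, len_one]; omega⟩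

theorem artinGrowthRate_spec [Finite V] : 1 ≤ artinGrowthRate Γ ∧
    Tendsto (fun n : ℕ => ((ball (stdGens Γ) n).ncard : ℝ) ^ (1 / (n : ℝ))) atTop
      (𝓝 (artinGrowthRate Γ)) ∧
    ∀ n, artinGrowthRate Γ ^ n ≤ ((ball (stdGens Γ) n).ncard : ℝ) := by
  obtain ⟨L, h1, h2, h3⟩ := exists_growth (u := fun n => ((ball (stdGens Γ) n).ncard : ℝ))
    (fun n => by exact_mod_cast one_le_ncard_ball n)
    (fun m n => by exact_mod_cast ncard_ball_add_le m n)
  have : artinGrowthRate Γ = L := h2.limUnder_eq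
  rw [this]
  exact ⟨h1, h2, h3⟩

theorem one_le_artinGrowthRate [Finite V] : 1 ≤ artinGrowthRate Γ := artinGrowthRate_spec.1

theorem sph_le_ncard_ball [Finite V] (n : ℕ) : sph Γ n ≤ (ball (stdGens Γ) n).ncard :=
  Set.ncard_le_ncard (fun _ hg => le_of_eq hg) (finite_ball n)

theorem exists_sph_le_mul_pow [Finite V] {μ : ℝ} (hμ : artinGrowthRate Γ < μ) :
    ∃ K : ℝ, 0 < K ∧ ∀ n, (sph Γ n : ℝ) ≤ K * μ ^ n := by
  obtain ⟨K, hK, h⟩ := exists_le_mul_pow (fun n => Nat.cast_nonneg _)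
    artinGrowthRate_spec.2.1 hμ (one_le_artinGrowthRate.trans hμ.le)
  exact ⟨K, hK, fun n => (Nat.cast_le.2 (sph_le_ncard_ball n)).trans (h n)⟩

/-- Passing from spheres to balls costs only one more factor `n + 1`. -/
theorem artinGrowthRate_le [Finite V] {μ K : ℝ} {d : ℕ} (hμ : 1 ≤ μ)
    (h : ∀ n, (sph Γ n : ℝ) ≤ K * ((n : ℝ) + 1) ^ d * μ ^ n) : artinGrowthRate Γ ≤ μ := by
  refine le_of_pow_le_mul_pow (K := K) (d := d + 1) (by linarith) fun n => ?_
  refine (artinGrowthRate_spec.2.2 n).trans ?_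
  have hK : 0 ≤ K := by
    have := h 0
    rw [sph_zero] at this
    simp at this
    linarith
  rw [ncard_ball, Nat.cast_sum]
  calc _ ≤ ∑ i ∈ Finset.range (n + 1), K * ((n : ℝ) + 1) ^ d * μ ^ n := by
        refine Finset.sum_le_sum fun i hi => (h i).trans ?_
        have hi' : i ≤ n := by rw [Finset.mem_range] at hi; omega
        gcongr
    _ = _ := by
        rw [Finset.sum_const, Finset.card_range, nsmul_eq_mul]
        push_cast
        ring

/-- In an irreducible group the sphere sizes are almost supermultiplicative. -/
theorem exists_sph_mul_le_mul [Finite V] [Nonempty V] (hΓ : Γᶜ.Preconnected) :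
    ∃ C, 0 < C ∧ ∀ m n, sph Γ m * sph Γ n ≤ C * sph Γ (m + n) := by
  rcases subsingleton_or_nontrivial V with hV | hV
  · refine ⟨4, by norm_num, fun m n => ?_⟩
    have h1 := sph_le_two (Γ := Γ) m
    have h2 := sph_le_two (Γ := Γ) n
    have h3 := sph_pos (Γ := Γ) (m + n)
    nlinarith
  · obtain ⟨u, -⟩ := exists_pair_ne V
    obtain ⟨w, hw⟩ := hΓ.exists_adj_of_nontrivial u
    rw [SimpleGraph.compl_adj] at hw
    obtain ⟨N, hN⟩ := exists_sph_mul_le hΓ hw.1 hw.2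
    refine ⟨4 * sph Γ N, Nat.mul_pos (by norm_num) (sph_pos N), fun m n => (hN m n).trans ?_⟩
    rw [mul_assoc, mul_comm (sph Γ N)]
    exact Nat.mul_le_mul_left _ (sph_add_le _ _)

/-- Pure exponential growth of an irreducible group. -/
theorem exists_sph_bounds [Finite V] [Nonempty V] (hΓ : Γᶜ.Preconnected) :
    ∃ C : ℝ, 1 ≤ C ∧ ∀ n, artinGrowthRate Γ ^ n ≤ sph Γ n ∧
      (sph Γ n : ℝ) ≤ C * artinGrowthRate Γ ^ n := by
  have h1 : ∀ n, (1 : ℝ) ≤ sph Γ n := fun n => by exact_mod_cast sph_pos n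
  have hlow : ∀ n, artinGrowthRate Γ ^ n ≤ sph Γ n := by
    obtain ⟨L, hL1, hL2, hL3⟩ := exists_growth (u := fun n => (sph Γ n : ℝ)) h1
      (fun m n => by exact_mod_cast sph_add_le m n)
    have hle : artinGrowthRate Γ ≤ L := by
      refine le_of_forall_gt_imp_ge_of_dense fun μ hμ => ?_
      obtain ⟨K, -, hK⟩ := exists_le_mul_pow (fun n => by positivity) hL2 hμ (hL1.trans hμ.le)
      exact artinGrowthRate_le (d := 0) (hL1.trans hμ.le) (by simpa using hK)
    exact fun n => (pow_le_pow_left₀ (by linarith [one_le_artinGrowthRate (Γ := Γ)]) hle n).trans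
      (hL3 n)
  obtain ⟨C, hC0, hC⟩ := exists_sph_mul_le_mul hΓ
  have hC0' : (0 : ℝ) < C := by exact_mod_cast hC0
  -- Iterating almost supermultiplicativity amplifies an excess at a single radius `n` to all
  -- multiples of `n`.
  have hpow : ∀ n k, ((sph Γ n : ℝ) / C) ^ k ≤ sph Γ (n * k) := by
    intro n k
    induction k with
    | zero => simpa using h1 0
    | succ k ih =>
      have h2 : (sph Γ (n * k) : ℝ) * sph Γ n ≤ C * sph Γ (n * k + n) := by
        exact_mod_cast hC (n * k) n
      rw [pow_succ, mul_add_one, mul_div_assoc', div_le_iff₀ hC0']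
      calc _ ≤ (sph Γ (n * k) : ℝ) * sph Γ n := by gcongr
        _ ≤ _ := by rw [mul_comm _ (C : ℝ)]; exact h2
  have hupp : ∀ n, (sph Γ n : ℝ) ≤ C * artinGrowthRate Γ ^ n := by
    intro n
    rw [mul_comm, ← div_le_iff₀ hC0']
    -- For each `μ` above the growth rate the amplified bound rules out an excess; then `μ`
    -- decreases to the growth rate.
    have key : ∀ μ, artinGrowthRate Γ < μ → (sph Γ n : ℝ) / C ≤ μ ^ n := by
      intro μ hμ
      obtain ⟨K, hK0, hK⟩ := exists_sph_le_mul_pow hμ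
      have hμ0 : 0 < μ := by linarith [one_le_artinGrowthRate (Γ := Γ)]
      refine le_of_pow_le_mul_pow (K := K) (d := 0) (pow_pos hμ0 n) fun k => ?_
      rw [pow_zero, mul_one, ← pow_mul]
      exact (hpow n k).trans (hK _)
    have ht : Tendsto (fun μ : ℝ => μ ^ n) (𝓝[>] (artinGrowthRate Γ))
        (𝓝 (artinGrowthRate Γ ^ n)) :=
      ((continuous_pow n).tendsto _).mono_left nhdsWithin_le_nhds
    exact ge_of_tendsto ht (by filter_upwards [self_mem_nhdsWithin] with μ hμ using key μ hμ)
  exact ⟨C, by exact_mod_cast hC0, fun n => ⟨hlow n, hupp n⟩⟩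

theorem artinGrowthRate_of_subsingleton [Finite V] [Subsingleton V] : artinGrowthRate Γ ≤ 1 := by
  refine artinGrowthRate_le (K := 2) (d := 0) le_rfl fun n => ?_
  simpa using (by exact_mod_cast sph_le_two n : (sph Γ n : ℝ) ≤ 2)

theorem exists_not_adj (hΓ : ¬∀ x y : ArtinGroup Γ, x * y = y * x) :
    ∃ u w, u ≠ w ∧ ¬Γ.Adj u w := by
  by_contra! h
  refine hΓ fun x y => ?_
  have hl : ∀ x y : V × Bool, Commute (letter Γ x) (letter Γ y) := by
    intro x y
    by_cases hxy : x.1 = y.1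
    · obtain ⟨v, _ | _⟩ := x <;> obtain ⟨w, _ | _⟩ := y <;> obtain rfl : v = w := hxy <;>
        simp [letter]
    · exact letter_commute (h _ _ hxy)
  have hly : ∀ (x : V × Bool) (y : ArtinGroup Γ), Commute (letter Γ x) y := by
    intro x y
    induction y using letter_induction with
    | h1 => exact Commute.one_right _
    | hm z g ih => exact (hl x z).mul_right ih
  change Commute x y
  induction x using letter_induction with
  | h1 => exact Commute.one_left _
  | hm z g ih => exact (hly z y).mul_left ih

/-- Positive words in `u` and `w` are geodesic by the exponent sum. Different ones spell different
elements, because a common element could start with both `u` and `w` only if they commuted. -/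
theorem two_le_artinGrowthRate [Finite V] {u w : V} (huw : u ≠ w) (hadj : ¬Γ.Adj u w) :
    2 ≤ artinGrowthRate Γ := by
  set φ : Bool → V × Bool := fun e => (cond e u w, true) with hφ
  have hgeo : ∀ l : List Bool, Geo Γ (l.map φ) := by
    intro l
    refine le_antisymm (len_word_le _) ?_
    have h1 : expSum Γ (word Γ (l.map φ)) = Multiplicative.ofAdd (l.length : ℤ) := by
      induction l with
      | nil => simp
      | cons e l ih =>
        rw [List.map_cons, word_cons, map_mul, ih, hφ, letter_true, expSum_gen, ← ofAdd_add]
        simp [add_comm]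
    have := natAbs_expSum_le (word Γ (l.map φ))
    rw [h1] at this
    simpa using this
  have hinj : ∀ l m : List Bool, l.length = m.length →
      word Γ (l.map φ) = word Γ (m.map φ) → l = m := by
    intro l
    induction l with
    | nil => intro m hm _; exact (List.length_eq_zero_iff.1 hm.symm).symm
    | cons e l ih =>
      rintro (_ | ⟨f, m⟩) hm heq
      · simp at hm
      have h1 : Starts Γ (φ e) (word Γ ((e :: l).map φ)) := (hgeo (e :: l)).starts
      have h2 : Starts Γ (φ f) (word Γ ((f :: m).map φ)) := (hgeo (f :: m)).starts
      rw [← heq] at h2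
      have hef : e = f := by
        by_contra hne
        have := h1.adj h2 (fun h => by
          have := congrArg Prod.fst h
          cases e <;> cases f <;> simp_all [φ])
        cases e <;> cases f <;> simp_all [φ, SimpleGraph.adj_comm]
      subst hef
      rw [List.map_cons, word_cons, List.map_cons, word_cons] at heq
      rw [ih m (by simpa using hm) (mul_left_cancel heq)]
  have hball : ∀ n, 2 ^ n ≤ (ball (stdGens Γ) n).ncard := by
    intro n
    have hc : (Set.univ : Set (Fin n → Bool)).ncard = 2 ^ n := by
      rw [Set.ncard_univ]; simp
    rw [← hc]
    refine Set.ncard_le_ncard_of_injOn (fun f => word Γ ((List.ofFn f).map φ)) ?_ ?_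
      (finite_ball n)
    · intro f _
      exact (len_word_le _).trans (by simp)
    · intro f _ g _ h
      exact List.ofFn_injective (hinj _ _ (by simp) h)
  refine ge_of_tendsto artinGrowthRate_spec.2.1 ?_
  filter_upwards [eventually_gt_atTop 0] with n hn
  have hn' : (n : ℝ) ≠ 0 := by positivity
  have h2 : ((2 : ℝ) ^ n) ^ (1 / (n : ℝ)) = 2 := by
    rw [← Real.rpow_natCast, ← Real.rpow_mul (by norm_num), mul_one_div_cancel hn', Real.rpow_one]
  rw [← h2]
  exact Real.rpow_le_rpow (by positivity) (by exact_mod_cast hball n) (by positivity)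

end Growth

/-! ### Induced subgraphs and the product decomposition of a join -/

section Factors

variable {V : Type*} {Γ : SimpleGraph V}

variable (Γ) in
/-- The inclusion of the group of an induced subgraph. -/
def incl (W : Set V) : ArtinGroup (Γ.induce W) →* ArtinGroup Γ :=
  lift (fun w => gen Γ w.1) fun _ _ h => gen_commute h

open Classical in
variable (Γ) in
/-- The retraction onto the group of an induced subgraph. -/
noncomputable def retr (W : Set V) : ArtinGroup Γ →* ArtinGroup (Γ.induce W) :=
  lift (fun v => if h : v ∈ W then gen (Γ.induce W) ⟨v, h⟩ else 1) fun v w h => by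
    by_cases hv : v ∈ W <;> by_cases hw : w ∈ W
    · simpa [hv, hw] using gen_commute (Γ := Γ.induce W) (v := ⟨v, hv⟩) (w := ⟨w, hw⟩) h
    all_goals simp [hv, hw]

theorem incl_letter (W : Set V) (x : W × Bool) :
    incl Γ W (letter (Γ.induce W) x) = letter Γ (x.1.1, x.2) := by
  obtain ⟨v, _ | _⟩ := x <;> simp [incl, letter]

theorem retr_letter_mem {W : Set V} {x : V × Bool} (h : x.1 ∈ W) :
    retr Γ W (letter Γ x) = letter (Γ.induce W) (⟨x.1, h⟩, x.2) := by
  obtain ⟨v, _ | _⟩ := x <;> dsimp only at h <;> simp [retr, letter, h]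

theorem retr_letter_not_mem {W : Set V} {x : V × Bool} (h : x.1 ∉ W) :
    retr Γ W (letter Γ x) = 1 := by
  obtain ⟨v, _ | _⟩ := x <;> dsimp only at h <;> simp [retr, letter, h]

theorem incl_gen (W : Set V) (v : W) : incl Γ W (gen (Γ.induce W) v) = gen Γ v.1 :=
  incl_letter W (v, true)

theorem retr_gen {W : Set V} {v : V} (h : v ∈ W) : retr Γ W (gen Γ v) = gen (Γ.induce W) ⟨v, h⟩ :=
  retr_letter_mem (x := (v, true)) h

theorem retr_incl (W : Set V) (g : ArtinGroup (Γ.induce W)) : retr Γ W (incl Γ W g) = g := by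
  induction g using letter_induction with
  | h1 => simp
  | hm x g ih => rw [map_mul, map_mul, ih, incl_letter, retr_letter_mem (h := x.1.2)]

theorem retr_compl_incl (W : Set V) (g : ArtinGroup (Γ.induce W)) :
    retr Γ Wᶜ (incl Γ W g) = 1 := by
  induction g using letter_induction with
  | h1 => simp
  | hm x g ih =>
    rw [map_mul, map_mul, ih, incl_letter, retr_letter_not_mem (W := Wᶜ) fun h => h x.1.2, one_mul]

theorem retr_incl_compl (W : Set V) (g : ArtinGroup (Γ.induce Wᶜ)) :
    retr Γ W (incl Γ Wᶜ g) = 1 := by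
  induction g using letter_induction with
  | h1 => simp
  | hm x g ih =>
    rw [map_mul, map_mul, ih, incl_letter, retr_letter_not_mem (Γ := Γ) (W := W) (x := (x.1.1, x.2)) x.1.2,
      one_mul]

theorem len_incl_le (W : Set V) (g : ArtinGroup (Γ.induce W)) : len (incl Γ W g) ≤ len g := by
  induction g using geodesic_induction with
  | h1 => simp
  | hm x g hx ih =>
    have := len_mul_le (letter Γ (x.1.1, x.2)) (incl Γ W g)
    rw [len_letter] at this
    rw [map_mul, incl_letter, len_letter_mul hx]
    omega

/-- Each letter survives in exactly one of the two retractions. -/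
theorem len_retr_add_le (W : Set V) (g : ArtinGroup Γ) :
    len (retr Γ W g) + len (retr Γ Wᶜ g) ≤ len g := by
  induction g using geodesic_induction with
  | h1 => simp
  | hm x g hx ih =>
    rw [map_mul, map_mul, len_letter_mul hx]
    by_cases h : x.1 ∈ W
    · rw [retr_letter_mem h, retr_letter_not_mem (W := Wᶜ) (fun h' => h' h), one_mul]
      have := len_mul_le (letter (Γ.induce W) (⟨x.1, h⟩, x.2)) (retr Γ W g)
      rw [len_letter] at this
      omega
    · have h' : x.1 ∈ Wᶜ := h
      rw [retr_letter_mem h', retr_letter_not_mem h, one_mul]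
      have := len_mul_le (letter (Γ.induce Wᶜ) (⟨x.1, h'⟩, x.2)) (retr Γ Wᶜ g)
      rw [len_letter] at this
      omega

theorem len_retr_le (W : Set V) (g : ArtinGroup Γ) : len (retr Γ W g) ≤ len g :=
  (Nat.le_add_right _ _).trans (len_retr_add_le W g)

variable {W : Set V}

theorem commute_incl (hW : ∀ v ∈ W, ∀ w ∉ W, Γ.Adj v w) (a : ArtinGroup (Γ.induce W))
    (b : ArtinGroup (Γ.induce Wᶜ)) : Commute (incl Γ W a) (incl Γ Wᶜ b) := by
  induction a using letter_induction with
  | h1 => simp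
  | hm x a iha =>
    rw [map_mul]
    refine Commute.mul_left ?_ iha
    clear iha
    induction b using letter_induction with
    | h1 => simp
    | hm y b ihb =>
      rw [map_mul]
      refine Commute.mul_right ?_ ihb
      rw [incl_letter, incl_letter]
      exact letter_commute (hW _ x.1.2 _ y.1.2)

theorem incl_retr_mul (hW : ∀ v ∈ W, ∀ w ∉ W, Γ.Adj v w) (g : ArtinGroup Γ) :
    incl Γ W (retr Γ W g) * incl Γ Wᶜ (retr Γ Wᶜ g) = g := by
  induction g using letter_induction with
  | h1 => simp
  | hm x g ih =>
    rw [map_mul, map_mul, map_mul, map_mul]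
    conv_rhs => rw [← ih]
    by_cases h : x.1 ∈ W
    · rw [retr_letter_mem h, retr_letter_not_mem (W := Wᶜ) (fun h' => h' h), incl_letter]
      simp [mul_assoc]
    · have h' : x.1 ∈ Wᶜ := h
      rw [retr_letter_mem h', retr_letter_not_mem h, incl_letter, map_one, one_mul]
      have := commute_incl hW (retr Γ W g) (letter _ (⟨x.1, h'⟩, x.2))
      rw [incl_letter] at this
      rw [← mul_assoc, this.eq, mul_assoc]

theorem len_retr_add (hW : ∀ v ∈ W, ∀ w ∉ W, Γ.Adj v w) (g : ArtinGroup Γ) :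
    len (retr Γ W g) + len (retr Γ Wᶜ g) = len g := by
  refine le_antisymm (len_retr_add_le W g) ?_
  have h1 := len_mul_le (incl Γ W (retr Γ W g)) (incl Γ Wᶜ (retr Γ Wᶜ g))
  rw [incl_retr_mul hW] at h1
  exact h1.trans (Nat.add_le_add (len_incl_le _ _) (len_incl_le _ _))

/-- The group of a join is the product of the groups of the two parts. -/
noncomputable def splitEquiv (hW : ∀ v ∈ W, ∀ w ∉ W, Γ.Adj v w) :
    ArtinGroup Γ ≃ ArtinGroup (Γ.induce W) × ArtinGroup (Γ.induce Wᶜ) where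
  toFun g := (retr Γ W g, retr Γ Wᶜ g)
  invFun p := incl Γ W p.1 * incl Γ Wᶜ p.2
  left_inv := incl_retr_mul hW
  right_inv p := by
    simp [retr_incl, retr_compl_incl, retr_incl_compl]

/-- Counting elements of given length whose components lie in given sets. -/
theorem ncard_sphere_inter_split [Finite V] (hW : ∀ v ∈ W, ∀ w ∉ W, Γ.Adj v w)
    (A : Set (ArtinGroup (Γ.induce W))) (n : ℕ) :
    (sphere (stdGens Γ) n ∩ {g | retr Γ W g ∈ A}).ncard =
      ∑ p ∈ Finset.HasAntidiagonal.antidiagonal n,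
        (sphere (stdGens (Γ.induce W)) p.1 ∩ A).ncard * sph (Γ.induce Wᶜ) p.2 := by
  classical
  have hfin : ∀ i, (sphere (stdGens (Γ.induce W)) i ∩ A).Finite := fun i =>
    (finite_sphere i).subset Set.inter_subset_left
  have hB : ∀ p : ℕ × ℕ, ((sphere (stdGens (Γ.induce W)) p.1 ∩ A) ×ˢ
      sphere (stdGens (Γ.induce Wᶜ)) p.2).Finite := fun p => (hfin p.1).prod (finite_sphere p.2)
  rw [← Set.ncard_image_of_injective _ (splitEquiv hW).injective]
  have himg : splitEquiv hW '' (sphere (stdGens Γ) n ∩ {g | retr Γ W g ∈ A}) =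
      ((Finset.HasAntidiagonal.antidiagonal n).biUnion fun p => (hB p).toFinset : Finset _) := by
    ext ⟨a, b⟩
    simp only [Finset.coe_biUnion, Set.Finite.coe_toFinset, Set.mem_iUnion, Finset.mem_coe,
      Finset.HasAntidiagonal.mem_antidiagonal, exists_prop]
    constructor
    · rintro ⟨g, ⟨hg, hA⟩, hab⟩
      simp only [splitEquiv, Equiv.coe_fn_mk, Prod.mk.injEq] at hab
      obtain ⟨rfl, rfl⟩ := hab
      exact ⟨(len (retr Γ W g), len (retr Γ Wᶜ g)), (len_retr_add hW g).trans hg,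
        ⟨rfl, hA⟩, rfl⟩
    · rintro ⟨⟨i, j⟩, hij, ⟨ha, hA⟩, hb⟩
      have e := (splitEquiv hW).apply_symm_apply (a, b)
      refine ⟨(splitEquiv hW).symm (a, b), ?_, e⟩
      obtain ⟨g, hg⟩ : ∃ g, g = (splitEquiv hW).symm (a, b) := ⟨_, rfl⟩
      rw [← hg] at e ⊢
      simp only [splitEquiv, Equiv.coe_fn_mk, Prod.mk.injEq] at e
      obtain ⟨rfl, rfl⟩ := e
      refine ⟨?_, hA⟩
      change len g = n
      rw [← len_retr_add hW, ← hij]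
      exact congrArg₂ _ ha hb
  rw [himg, Set.ncard_coe_finset, Finset.card_biUnion]
  · refine Finset.sum_congr rfl fun p _ => ?_
    rw [← Set.ncard_eq_toFinset_card _ (hB p), Set.ncard_prod, sph]
  · rintro ⟨i, j⟩ _ ⟨i', j'⟩ _ hne
    rw [Function.onFun, Finset.disjoint_left]
    rintro ⟨a, b⟩ h1 h2
    rw [Set.Finite.mem_toFinset] at h1 h2
    refine hne (Prod.ext ?_ ?_)
    · exact h1.1.1.symm.trans h2.1.1
    · exact h1.2.symm.trans h2.2

theorem sph_eq_sum [Finite V] (hW : ∀ v ∈ W, ∀ w ∉ W, Γ.Adj v w) (n : ℕ) :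
    sph Γ n = ∑ p ∈ Finset.HasAntidiagonal.antidiagonal n, sph (Γ.induce W) p.1 * sph (Γ.induce Wᶜ) p.2 := by
  have := ncard_sphere_inter_split hW Set.univ n
  simpa [sph] using this

theorem hasPow_incl_of_hasPow {v : W} {k : ℤ} {g : ArtinGroup (Γ.induce W)}
    (hW : ∀ v ∈ W, ∀ w ∉ W, Γ.Adj v w) {b : ArtinGroup (Γ.induce Wᶜ)} (h : HasPow v k g) :
    HasPow v.1 k (incl Γ W g * incl Γ Wᶜ b) := by
  obtain ⟨c, d, rfl, hl⟩ := h
  refine ⟨incl Γ W c, incl Γ W d * incl Γ Wᶜ b, ?_, ?_⟩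
  · rw [map_mul, map_mul, map_zpow, incl_gen, mul_assoc]
  · rw [← len_retr_add hW, ← len_retr_add hW (incl Γ W c),
      ← len_retr_add hW (incl Γ W d * _)]
    simp only [map_mul (retr Γ W), map_mul (retr Γ Wᶜ), retr_incl, retr_compl_incl,
      retr_incl_compl, len_one, one_mul, mul_one]
    omega

/-- Lengths add over the two factors and `v ^ k` lies in one of them, so a geodesic factorisation
projects to a geodesic one. Conversely, the other component is appended at the end. -/
theorem hasPow_iff (hW : ∀ v ∈ W, ∀ w ∉ W, Γ.Adj v w) {v : V} (hv : v ∈ W) {k : ℤ}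
    {g : ArtinGroup Γ} : HasPow v k g ↔ HasPow ⟨v, hv⟩ k (retr Γ W g) := by
  constructor
  · rintro ⟨a, b, rfl, hl⟩
    refine ⟨retr Γ W a, retr Γ W b, by rw [map_mul, map_mul, map_zpow, retr_gen hv], ?_⟩
    have h1 := len_retr_add hW a
    have h2 := len_retr_add hW b
    have h3 := len_retr_add hW (a * gen Γ v ^ k * b)
    have h4 : retr Γ Wᶜ (gen Γ v) = 1 :=
      retr_letter_not_mem (x := (v, true)) (W := Wᶜ) fun h => h hv
    have h5 := len_mul_le (retr Γ Wᶜ a) (retr Γ Wᶜ b)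
    have h6 : retr Γ Wᶜ (a * gen Γ v ^ k * b) = retr Γ Wᶜ a * retr Γ Wᶜ b := by
      rw [map_mul, map_mul, map_zpow, h4, one_zpow, mul_one]
    have h7 := len_mul_le (retr Γ W a * gen (Γ.induce W) ⟨v, hv⟩ ^ k) (retr Γ W b)
    have h8 := len_mul_le (retr Γ W a) (gen (Γ.induce W) ⟨v, hv⟩ ^ k)
    have h9 : retr Γ W (a * gen Γ v ^ k * b) =
      retr Γ W a * gen (Γ.induce W) ⟨v, hv⟩ ^ k * retr Γ W b := by
        rw [map_mul, map_mul, map_zpow, retr_gen hv]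
    rw [len_gen_zpow] at h8
    rw [h6] at h3
    rw [h9] at h3 ⊢
    omega
  · intro h
    rw [← incl_retr_mul hW g]
    exact hasPow_incl_of_hasPow hW h

end Factors

/-! ### The component of a vertex in the complement graph -/

section Component

variable {V : Type*} {Γ : SimpleGraph V}

/-- This exhibits Γ as a join, which is the hypothesis for splitting the group as a product. -/
theorem adj_of_component (v : V) : ∀ u ∈ {w : V | Γᶜ.Reachable v w},
    ∀ w ∉ {w : V | Γᶜ.Reachable v w}, Γ.Adj u w := by
  intro u hu w hw
  by_contra h
  refine hw (SimpleGraph.Reachable.trans hu (SimpleGraph.Adj.reachable ?_))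
  rw [SimpleGraph.compl_adj]
  refine ⟨?_, h⟩
  rintro rfl
  exact hw hu

theorem preconnected_factorGraph (v : V) : (factorGraph Γ v)ᶜ.Preconnected := by
  have hstep : ∀ (u w : {w : V | Γᶜ.Reachable v w}), Γᶜ.Adj u.1 w.1 →
      (factorGraph Γ v)ᶜ.Adj u w := by
    intro u w h
    rw [SimpleGraph.compl_adj] at h ⊢
    exact ⟨fun e => h.1 (congrArg Subtype.val e), h.2⟩
  have key : ∀ (a b : V) (p : Γᶜ.Walk a b) (ha : Γᶜ.Reachable v a) (hb : Γᶜ.Reachable v b),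
      (factorGraph Γ v)ᶜ.Reachable ⟨a, ha⟩ ⟨b, hb⟩ := by
    intro a b p
    induction p with
    | nil => intro _ _; rfl
    | @cons a c b h q ih =>
      intro ha hb
      have hc : Γᶜ.Reachable v c := ha.trans h.reachable
      exact (hstep ⟨a, ha⟩ ⟨c, hc⟩ h).reachable.trans (ih hc hb)
  rintro ⟨a, ha⟩ ⟨b, hb⟩
  obtain ⟨p⟩ := ha.symm.trans hb
  exact key a b p ha hb

end Component

/-! ### Excursions expressed through powers in geodesic words -/

section Excursion

variable {V : Type*} {Γ : SimpleGraph V}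

theorem wordDist_comm (x y : ArtinGroup Γ) :
    wordDist (stdGens Γ) x y = wordDist (stdGens Γ) y x := by
  change len _ = len _
  rw [← len_inv]
  simp

theorem IsGeodesicTo.dist_le {g : ArtinGroup Γ} {γ : ℕ → ArtinGroup Γ}
    (h : IsGeodesicTo (stdGens Γ) g γ) {i j : ℕ} (hi : i ≤ len g) (hj : j ≤ len g) :
    wordDist (stdGens Γ) (γ i) (γ j) ≤ len g := by
  rcases le_total i j with hij | hij
  · rw [h.2.2 i j hij hj]; omega
  · rw [wordDist_comm, h.2.2 j i hij hi]; omega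

theorem IsGeodesicTo.diam_le {g : ArtinGroup Γ} {γ : ℕ → ArtinGroup Γ}
    (h : IsGeodesicTo (stdGens Γ) g γ) (A : Set (ArtinGroup Γ)) :
    ∀ d ∈ {d : ℕ | ∃ x ∈ γ '' Set.Iic (len g) ∩ A, ∃ y ∈ γ '' Set.Iic (len g) ∩ A,
      d = wordDist (stdGens Γ) x y}, d ≤ len g := by
  rintro d ⟨x, ⟨⟨i, hi, rfl⟩, -⟩, y, ⟨⟨j, hj, rfl⟩, -⟩, rfl⟩
  exact h.dist_le hi hj

theorem IsGeodesicTo.pathExcursion_le {g : ArtinGroup Γ} {γ : ℕ → ArtinGroup Γ}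
    (h : IsGeodesicTo (stdGens Γ) g γ) (H : Subgroup (ArtinGroup Γ)) :
    pathExcursion (stdGens Γ) H (len g) γ ≤ len g := by
  refine csSup_le' ?_
  rintro d ⟨t, rfl⟩
  exact csSup_le' (h.diam_le _)

theorem Geo.append {l m : List (V × Bool)} (h : Geo Γ (l ++ m)) : Geo Γ l ∧ Geo Γ m := by
  have h1 := len_word_le (Γ := Γ) l
  have h2 := len_word_le (Γ := Γ) m
  have h3 := len_mul_le (word Γ l) (word Γ m)
  rw [Geo, word_append, List.length_append] at h
  rw [Geo, Geo]
  omega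

theorem Geo.isGeodesicTo {l : List (V × Bool)} (h : Geo Γ l) :
    IsGeodesicTo (stdGens Γ) (word Γ l) fun i => word Γ (l.take i) := by
  have hn : wordLength (stdGens Γ) (word Γ l) = l.length := h
  refine ⟨by simp, by simp [hn], fun i j hij hj => ?_⟩
  rw [hn] at hj
  have e : l.take i ++ (l.take j).drop i = l.take j := by
    conv_rhs => rw [← List.take_append_drop i (l.take j), List.take_take, min_eq_left hij]
  have h1 : Geo Γ (l.take j) := (Geo.append (m := l.drop j) (by rwa [List.take_append_drop])).1
  rw [← e] at h1
  have h2 : len (word Γ ((l.take j).drop i)) = j - i := by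
    rw [h1.append.2]
    simp [hj]
  have e' : word Γ (l.take j) = word Γ (l.take i) * word Γ ((l.take j).drop i) := by
    rw [← word_append, e]
  rw [← h2]
  dsimp only
  rw [e', wordDist, inv_mul_cancel_left]

/-- A geodesic through `a` and `a v ^ k` meets the coset of `a` in two points at distance |k|. Each
supremum in ℕ also needs an upper bound, here `len g`. -/
theorem natAbs_le_vertexExcursion {v : V} {k : ℤ} {g : ArtinGroup Γ} (h : HasPow v k g) :
    k.natAbs ≤ vertexExcursion Γ v g := by
  obtain ⟨a, b, hg, hl⟩ := h
  obtain ⟨la, hla, hla'⟩ := exists_geodesic_word a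
  obtain ⟨lk, hlk, hlk'⟩ := exists_geodesic_word (gen Γ v ^ k)
  obtain ⟨lb, hlb, hlb'⟩ := exists_geodesic_word b
  rw [len_gen_zpow] at hlk'
  have hw : word Γ (la ++ lk ++ lb) = g := by
    rw [word_append, word_append, hla, hlk, hlb, hg]
  have hgeo : Geo Γ (la ++ lk ++ lb) := by
    rw [Geo, hw, hl, List.length_append, List.length_append, hla', hlk', hlb']
  have hγ := hgeo.isGeodesicTo
  rw [hw] at hγ
  set γ : ℕ → ArtinGroup Γ := fun i => word Γ ((la ++ lk ++ lb).take i) with hγdef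
  have h1 : γ (len a) = a := by
    simp only [hγdef]
    rw [List.append_assoc, ← hla', List.take_left, hla]
  have h2 : γ (len a + k.natAbs) = a * gen Γ v ^ k := by
    simp only [hγdef]
    rw [← hla', ← hlk', ← List.length_append, List.take_left, word_append, hla, hlk]
  have hdiam : k.natAbs ≤ diam (stdGens Γ)
      (γ '' Set.Iic (len g) ∩ a • (Subgroup.zpowers (gen Γ v) : Set (ArtinGroup Γ))) := by
    refine le_csSup ⟨_, hγ.diam_le _⟩ ⟨a, ⟨⟨len a, ?_, h1⟩, ?_⟩, a * gen Γ v ^ k,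
      ⟨⟨len a + k.natAbs, ?_, h2⟩, ?_⟩, ?_⟩
    · change len a ≤ len g; omega
    · exact ⟨1, Subgroup.one_mem _, by simp⟩
    · change len a + k.natAbs ≤ len g; omega
    · exact ⟨gen Γ v ^ k, Subgroup.zpow_mem _ (Subgroup.mem_zpowers _) k, by simp⟩
    · rw [wordDist, inv_mul_cancel_left]
      exact (len_gen_zpow v k).symm
  have hpath : k.natAbs ≤
      pathExcursion (stdGens Γ) (Subgroup.zpowers (gen Γ v)) (len g) γ := by
    refine hdiam.trans (le_csSup ⟨len g, ?_⟩ ⟨a, rfl⟩)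
    rintro d ⟨t, rfl⟩
    exact csSup_le' (hγ.diam_le _)
  refine hpath.trans (le_csSup ⟨len g, ?_⟩ ⟨γ, hγ, rfl⟩)
  rintro d ⟨δ, hδ, rfl⟩
  exact hδ.pathExcursion_le _

/-- Two points of a geodesic in one coset of ⟨v⟩ differ by a power of `v`, and the geodesic then
factors around that power. -/
theorem hasPow_of_le_vertexExcursion {v : V} {n : ℕ} {g : ArtinGroup Γ} (hn : 1 ≤ n)
    (h : n ≤ vertexExcursion Γ v g) : HasPow v n g ∨ HasPow v (-n) g := by
  by_contra hcon
  have hcon' : ∀ k : ℤ, HasPow v k g → k.natAbs ≤ n - 1 := by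
    intro k hk
    by_contra hlt
    exact hcon (hk.mono (by omega))
  have hle : vertexExcursion Γ v g ≤ n - 1 := by
    refine csSup_le' ?_
    rintro d ⟨γ, hγ, rfl⟩
    refine csSup_le' ?_
    rintro d ⟨t, rfl⟩
    refine csSup_le' ?_
    have key : ∀ i j, i ≤ j → j ≤ len g → ∀ k : ℤ, (γ i)⁻¹ * γ j = gen Γ v ^ k →
        wordDist (stdGens Γ) (γ i) (γ j) ≤ n - 1 := by
      intro i j hij hj k hk
      have h1 := hγ.2.2 0 i (Nat.zero_le _) (hij.trans hj)
      have h2 := hγ.2.2 i j hij hj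
      have h3 := hγ.2.2 j (len g) hj le_rfl
      rw [hγ.1] at h1
      rw [hγ.2.1] at h3
      rw [wordDist, inv_one, one_mul] at h1
      rw [wordDist, hk] at h2 ⊢
      have h4 := len_gen_zpow (Γ := Γ) v k
      rw [wordDist] at h3
      refine h4.trans_le (hcon' k ⟨γ i, (γ j)⁻¹ * g, ?_, ?_⟩)
      · rw [← hk]; group
      · simp only [len] at *
        omega
    rintro d ⟨x, ⟨⟨i, hi, rfl⟩, p, ⟨a, rfl⟩, hp⟩, y, ⟨⟨j, hj, rfl⟩, q, ⟨b, rfl⟩, hq⟩, rfl⟩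
    simp only [smul_eq_mul] at hp hq
    rcases le_total i j with hij | hij
    · refine key i j hij hj (b - a) ?_
      rw [← hp, ← hq, sub_eq_neg_add, zpow_add, zpow_neg]
      group
    · rw [wordDist_comm]
      refine key j i hij hi (a - b) ?_
      rw [← hp, ← hq, sub_eq_neg_add, zpow_add, zpow_neg]
      group
  omega

end Excursion

/-! ### Convolutions of sequences and the spreading condition -/

section Convolution

/-- The convolution of two sequences. -/
def conv (t u : ℕ → ℝ) (n : ℕ) : ℝ := ∑ p ∈ Finset.HasAntidiagonal.antidiagonal n, t p.1 * u p.2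

theorem conv_comm (t u : ℕ → ℝ) (n : ℕ) : conv t u n = conv u t n := by
  rw [conv, conv, ← Finset.Nat.sum_antidiagonal_swap]
  exact Finset.sum_congr rfl fun p _ => mul_comm _ _

theorem conv_eq_sum_range (t u : ℕ → ℝ) (n : ℕ) :
    conv t u n = ∑ i ∈ Finset.range (n + 1), t i * u (n - i) :=
  Finset.Nat.sum_antidiagonal_eq_sum_range_succ (fun i j => t i * u j) n

theorem sum_conv (t u : ℕ → ℝ) (n : ℕ) : ∑ m ∈ Finset.range (n + 1), conv t u m =
    conv (fun i => ∑ m ∈ Finset.range (i + 1), t m) u n := by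
  induction n with
  | zero => simp [conv]
  | succ n ih =>
    rw [Finset.sum_range_succ, ih, conv, conv, conv, Finset.Nat.sum_antidiagonal_succ,
      Finset.Nat.sum_antidiagonal_succ]
    simp only [Finset.sum_range_succ _ (_ + 1), add_mul, Finset.sum_add_distrib]
    simp
    ring

/-- No short range of indices near `k` carries most of the sum of `t` up to `k`. -/
def Spread (t : ℕ → ℝ) : Prop :=
  ∃ A : ℝ, ∀ k : ℕ, ((k : ℝ) + 1) * t k ≤ A * ∑ i ∈ Finset.range (k + 1), t i

/-- For i + j = k one has k + 1 ≤ (i + 1) + (j + 1), so the weight can be spent on one factor at a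
time. -/
theorem Spread.conv {t u : ℕ → ℝ} (ht : Spread t) (hu : Spread u) (ht0 : ∀ n, 0 ≤ t n)
    (hu0 : ∀ n, 0 ≤ u n) : Spread (conv t u) := by
  obtain ⟨A, hA⟩ := ht
  obtain ⟨B, hB⟩ := hu
  refine ⟨A + B, fun k => ?_⟩
  have h1 : ∑ m ∈ Finset.range (k + 1), RAAG.conv t u m =
      RAAG.conv t (fun i => ∑ m ∈ Finset.range (i + 1), u m) k := by
    rw [conv_comm, ← sum_conv]
    exact Finset.sum_congr rfl fun m _ => conv_comm _ _ _
  have h2 := sum_conv t u k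
  rw [add_mul A B]
  nth_rw 1 [h2]
  rw [h1]
  simp only [RAAG.conv, Finset.mul_sum, ← Finset.sum_add_distrib]
  refine Finset.sum_le_sum fun p hp => ?_
  have hk : (k : ℝ) + 1 ≤ ((p.1 : ℝ) + 1) + ((p.2 : ℝ) + 1) := by
    rw [← Finset.HasAntidiagonal.mem_antidiagonal.1 hp]
    push_cast
    linarith
  calc ((k : ℝ) + 1) * (t p.1 * u p.2)
      ≤ (((p.1 : ℝ) + 1) + ((p.2 : ℝ) + 1)) * (t p.1 * u p.2) :=
        mul_le_mul_of_nonneg_right hk (mul_nonneg (ht0 _) (hu0 _))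
    _ = ((p.1 : ℝ) + 1) * t p.1 * u p.2 + t p.1 * (((p.2 : ℝ) + 1) * u p.2) := by ring
    _ ≤ A * (∑ i ∈ Finset.range (p.1 + 1), t i) * u p.2 +
        t p.1 * (B * ∑ i ∈ Finset.range (p.2 + 1), u i) :=
        add_le_add (mul_le_mul_of_nonneg_right (hA _) (hu0 _))
          (mul_le_mul_of_nonneg_left (hB _) (ht0 _))
    _ = _ := by simp only [← Finset.mul_sum]; ring

/-- Growth of one sequence is enough: shift it in every term and discard the extra terms of the
longer convolution. -/
theorem le_conv_add {t u : ℕ → ℝ} {c ρ : ℝ} (h : ∀ n k, c * ρ ^ k * t n ≤ t (n + k))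
    (ht0 : ∀ n, 0 ≤ t n) (hu0 : ∀ n, 0 ≤ u n) (n k : ℕ) :
    c * ρ ^ k * conv t u n ≤ conv t u (n + k) := by
  rw [conv_comm, conv_comm t, conv_eq_sum_range, conv_eq_sum_range, Finset.mul_sum]
  calc _ ≤ ∑ i ∈ Finset.range (n + 1), u i * t (n + k - i) := by
        refine Finset.sum_le_sum fun i hi => ?_
        have hi' : i ≤ n := by rw [Finset.mem_range] at hi; omega
        rw [show n + k - i = n - i + k by omega]
        have := mul_le_mul_of_nonneg_left (h (n - i) k) (hu0 i)
        linarith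
    _ ≤ _ := by
        refine Finset.sum_le_sum_of_subset_of_nonneg ?_ fun i _ _ => mul_nonneg (hu0 _) (ht0 _)
        intro i hi
        rw [Finset.mem_range] at *
        omega

end Convolution

/-! ### Sphere sizes of a product in terms of its factors -/

section FactorGrowth

universe u

variable {V : Type u} {Γ : SimpleGraph V}

theorem len_incl (W : Set V) (g : ArtinGroup (Γ.induce W)) : len (incl Γ W g) = len g := by
  refine le_antisymm (len_incl_le W g) ?_
  have := len_retr_le W (incl Γ W g)
  rwa [retr_incl] at this

theorem sph_induce_le [Finite V] (W : Set V) (n : ℕ) : sph (Γ.induce W) n ≤ sph Γ n := by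
  refine Set.ncard_le_ncard_of_injOn (incl Γ W) ?_ ?_ (finite_sphere n)
  · intro g hg
    exact (len_incl W g).trans hg
  · intro g _ h _ hgh
    rw [← retr_incl W g, hgh, retr_incl]

theorem artinGrowthRate_induce_le [Finite V] (W : Set V) :
    artinGrowthRate (Γ.induce W) ≤ artinGrowthRate Γ := by
  refine le_of_forall_gt_imp_ge_of_dense fun μ hμ => ?_
  obtain ⟨K, -, hK⟩ := exists_sph_le_mul_pow hμ
  refine artinGrowthRate_le (K := K) (d := 0) (one_le_artinGrowthRate.trans hμ.le) fun n => ?_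
  rw [pow_zero, mul_one]
  exact (Nat.cast_le.2 (sph_induce_le W n)).trans (hK n)

theorem sph_eq_conv [Finite V] {W : Set V} (hW : ∀ v ∈ W, ∀ w ∉ W, Γ.Adj v w) (n : ℕ) :
    (sph Γ n : ℝ) =
      conv (fun i => (sph (Γ.induce W) i : ℝ)) (fun i => (sph (Γ.induce Wᶜ) i : ℝ)) n := by
  rw [sph_eq_sum hW, conv]
  push_cast
  rfl

theorem artinGrowthRate_le_max [Finite V] {W : Set V} (hW : ∀ v ∈ W, ∀ w ∉ W, Γ.Adj v w) :
    artinGrowthRate Γ ≤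
      max (artinGrowthRate (Γ.induce W)) (artinGrowthRate (Γ.induce Wᶜ)) := by
  refine le_of_forall_gt_imp_ge_of_dense fun μ hμ => ?_
  rw [max_lt_iff] at hμ
  obtain ⟨K, hK0, hK⟩ := exists_sph_le_mul_pow hμ.1
  obtain ⟨L, hL0, hL⟩ := exists_sph_le_mul_pow hμ.2
  have hμ1 : 1 ≤ μ := one_le_artinGrowthRate.trans hμ.1.le
  refine artinGrowthRate_le (K := K * L) (d := 1) hμ1 fun n => ?_
  rw [sph_eq_conv hW, conv]
  calc _ ≤ ∑ p ∈ Finset.HasAntidiagonal.antidiagonal n, K * L * μ ^ n := by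
        refine Finset.sum_le_sum fun p hp => ?_
        rw [← Finset.HasAntidiagonal.mem_antidiagonal.1 hp, pow_add]
        calc _ ≤ (K * μ ^ p.1) * (L * μ ^ p.2) := by
              gcongr
              · exact hK _
              · exact hL _
          _ = _ := by ring
    _ = _ := by
        rw [Finset.sum_const, Finset.Nat.card_antidiagonal, nsmul_eq_mul]
        push_cast
        ring

theorem nonempty_component (v : V) : Nonempty {w : V | Γᶜ.Reachable v w} :=
  ⟨⟨v, SimpleGraph.Reachable.refl v⟩⟩

theorem card_compl_component_lt [Finite V] (v : V) :
    Nat.card ({w : V | Γᶜ.Reachable v w}ᶜ : Set V) < Nat.card V := by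
  have h : ({w : V | Γᶜ.Reachable v w}ᶜ : Set V) ⊂ Set.univ := by
    rw [Set.ssubset_univ_iff, Ne, Set.compl_univ_iff]
    exact Set.Nonempty.ne_empty ⟨v, SimpleGraph.Reachable.refl v⟩
  rw [Nat.card_coe_set_eq, ← Set.ncard_univ]
  exact Set.ncard_lt_ncard h

theorem exists_factorGraph_bounds [Finite V] (v : V) :
    ∃ C : ℝ, 1 ≤ C ∧ ∀ n, artinGrowthRate (factorGraph Γ v) ^ n ≤ sph (factorGraph Γ v) n ∧
      (sph (factorGraph Γ v) n : ℝ) ≤ C * artinGrowthRate (factorGraph Γ v) ^ n :=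
  have := nonempty_component (Γ := Γ) v
  exists_sph_bounds (preconnected_factorGraph v)

theorem sph_of_isEmpty [IsEmpty V] {n : ℕ} (hn : n ≠ 0) : sph Γ n = 0 := by
  have : sphere (stdGens Γ) n = ∅ := by
    rw [Set.eq_empty_iff_forall_notMem]
    intro g hg
    obtain ⟨l, rfl⟩ := exists_word g
    cases l with
    | nil => exact hn (hg.symm.trans len_one)
    | cons x _ => exact IsEmpty.elim ‹_› x.1
  rw [sph, this, Set.ncard_empty]

/-- Induction on the number of vertices, splitting off one irreducible factor. Its normalised sphere
sizes are comparable to a nonincreasing geometric sequence, and `Spread.conv` adds the rest. -/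
theorem spread_sph [Finite V] (Γ : SimpleGraph V) {r : ℝ} (hr : artinGrowthRate Γ ≤ r) :
    Spread fun n => sph Γ n / r ^ n := by
  induction hc : Nat.card V using Nat.strong_induction_on generalizing V with
  | _ N ih =>
    have hr0 : 0 < r := by linarith [one_le_artinGrowthRate (Γ := Γ)]
    rcases isEmpty_or_nonempty V with hV | ⟨⟨v⟩⟩
    · refine ⟨1, fun k => ?_⟩
      rcases eq_or_ne k 0 with rfl | hk
      · simp
      · dsimp only
        rw [sph_of_isEmpty hk]
        simp only [Nat.cast_zero, zero_div, mul_zero, one_mul]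
        exact Finset.sum_nonneg fun i _ => by positivity
    have hW := adj_of_component (Γ := Γ) v
    set W := {w : V | Γᶜ.Reachable v w} with hWdef
    have h1 : Spread fun n => sph (Γ.induce W) n / r ^ n := by
      obtain ⟨C, hC1, hC⟩ := exists_factorGraph_bounds (Γ := Γ) v
      have hL1 : 1 ≤ artinGrowthRate (factorGraph Γ v) := one_le_artinGrowthRate
      have hLr : artinGrowthRate (factorGraph Γ v) ≤ r := (artinGrowthRate_induce_le W).trans hr
      set L := artinGrowthRate (factorGraph Γ v)
      have hq0 : 0 ≤ L / r := by positivity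
      have hq1 : L / r ≤ 1 := (div_le_one hr0).2 hLr
      refine ⟨C, fun k => ?_⟩
      have h2 : (sph (Γ.induce W) k : ℝ) / r ^ k ≤ C * (L / r) ^ k := by
        rw [div_pow, mul_div_assoc']
        exact div_le_div_of_nonneg_right (hC k).2 (by positivity)
      have h3 : ((k : ℝ) + 1) * (L / r) ^ k ≤
          ∑ i ∈ Finset.range (k + 1), (sph (Γ.induce W) i : ℝ) / r ^ i := by
        -- As L/r ≤ 1, the last term is at most each of the k + 1 earlier or equal ones.
        calc ((k : ℝ) + 1) * (L / r) ^ k = ∑ i ∈ Finset.range (k + 1), (L / r) ^ k := by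
              rw [Finset.sum_const, Finset.card_range, nsmul_eq_mul]
              push_cast
              ring
          _ ≤ _ := by
              refine Finset.sum_le_sum fun i hi => ?_
              rw [Finset.mem_range] at hi
              refine (pow_le_pow_of_le_one hq0 hq1 (by omega : i ≤ k)).trans ?_
              rw [div_pow]
              exact div_le_div_of_nonneg_right (hC i).1 (by positivity)
      calc _ ≤ ((k : ℝ) + 1) * (C * (L / r) ^ k) := by gcongr
        _ = C * (((k : ℝ) + 1) * (L / r) ^ k) := by ring
        _ ≤ _ := by gcongr
    have h2 := ih _ (hc ▸ card_compl_component_lt (Γ := Γ) v) (Γ.induce Wᶜ)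
      ((artinGrowthRate_induce_le Wᶜ).trans hr) rfl
    have h3 := h1.conv h2 (fun n => by positivity) fun n => by positivity
    convert h3 using 2 with n
    rw [sph_eq_conv hW, conv, conv, Finset.sum_div]
    refine Finset.sum_congr rfl fun p hp => ?_
    rw [← Finset.HasAntidiagonal.mem_antidiagonal.1 hp, pow_add]
    field_simp

/-- One of the two factors grows at least at rate ρ, and `le_conv_add` passes its bound to the
product. The condition 1 < ρ excludes the empty graph. -/
theorem exists_mul_pow_mul_sph_le [Finite V] (Γ : SimpleGraph V) {ρ : ℝ} (h1 : 1 < ρ)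
    (hρ : ρ ≤ artinGrowthRate Γ) :
    ∃ c : ℝ, 0 < c ∧ ∀ n k, c * ρ ^ k * sph Γ n ≤ sph Γ (n + k) := by
  induction hc : Nat.card V using Nat.strong_induction_on generalizing V with
  | _ N ih =>
    rcases isEmpty_or_nonempty V with hV | ⟨⟨v⟩⟩
    · linarith [artinGrowthRate_of_subsingleton (Γ := Γ)]
    have hW := adj_of_component (Γ := Γ) v
    set W := {w : V | Γᶜ.Reachable v w} with hWdef
    simp_rw [sph_eq_conv hW]
    rcases le_max_iff.1 (hρ.trans (artinGrowthRate_le_max hW)) with h | h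
    · obtain ⟨C, hC1, hC⟩ := exists_factorGraph_bounds (Γ := Γ) v
      have hC0 : 0 < C := by linarith
      change ρ ≤ artinGrowthRate (factorGraph Γ v) at h
      refine ⟨1 / C, by positivity, le_conv_add (fun n k => ?_) (fun n => by positivity)
        fun n => by positivity⟩
      set L := artinGrowthRate (factorGraph Γ v)
      have hL : 0 ≤ L := by linarith
      calc 1 / C * ρ ^ k * (sph (Γ.induce W) n : ℝ) ≤ 1 / C * L ^ k * (C * L ^ n) := by
            gcongr
            exact (hC n).2
        _ = L ^ (n + k) := by rw [pow_add]; field_simp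
        _ ≤ _ := (hC (n + k)).1
    · obtain ⟨c, hc0, hcc⟩ := ih _ (hc ▸ card_compl_component_lt (Γ := Γ) v) (Γ.induce Wᶜ) h rfl
      refine ⟨c, hc0, fun n k => ?_⟩
      rw [conv_comm, conv_comm (fun i => (sph (Γ.induce W) i : ℝ))]
      exact le_conv_add hcc (fun n => by positivity) (fun n => by positivity) n k

end FactorGrowth

/-! ### Probability estimates on spheres -/

section Probability

variable {V : Type*} {Γ : SimpleGraph V}

theorem sphereProb_le_one [Finite V] (n : ℕ) (A : Set (ArtinGroup Γ)) :
    sphereProb (stdGens Γ) n A ≤ 1 := by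
  refine div_le_one_of_le₀ ?_ (Nat.cast_nonneg _)
  exact_mod_cast Set.ncard_le_ncard Set.inter_subset_left (finite_sphere n)

theorem one_sub_le_sphereProb [Finite V] [Nonempty V] {n : ℕ} {A B : Set (ArtinGroup Γ)}
    (h : Aᶜ ⊆ B) {x : ℝ} (hB : ((sphere (stdGens Γ) n ∩ B).ncard : ℝ) ≤ x * sph Γ n) :
    1 - x ≤ sphereProb (stdGens Γ) n A := by
  have hpos : (0 : ℝ) < sph Γ n := by exact_mod_cast sph_pos n
  change _ ≤ _ / (sph Γ n : ℝ)
  rw [le_div_iff₀ hpos]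
  have h1 := Set.ncard_inter_add_ncard_sdiff_eq_ncard (sphere (stdGens Γ) n) A (finite_sphere n)
  have h2 : (sphere (stdGens Γ) n \ A).ncard ≤ (sphere (stdGens Γ) n ∩ B).ncard :=
    Set.ncard_le_ncard (Set.inter_subset_inter_right _ h)
      ((finite_sphere n).subset Set.inter_subset_left)
  have h3 : ((sphere (stdGens Γ) n ∩ A).ncard : ℝ) + (sphere (stdGens Γ) n \ A).ncard = sph Γ n := by
    exact_mod_cast h1
  have h4 : ((sphere (stdGens Γ) n \ A).ncard : ℝ) ≤ (sphere (stdGens Γ) n ∩ B).ncard := by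
    exact_mod_cast h2
  linarith

/-- If the factor of `v` grows more slowly than the group, then the excursion vanishes with
probability bounded below. -/
theorem exists_le_sphereProb_vertexExcursion_eq_zero [Finite V] (v : V)
    (h : artinGrowthRate (factorGraph Γ v) < artinGrowthRate Γ) :
    ∃ δ : ℝ, 0 < δ ∧ ∀ n, δ ≤ sphereProb (stdGens Γ) n {g | vertexExcursion Γ v g = 0} := by
  have hV : Nonempty V := ⟨v⟩
  have hW := adj_of_component (Γ := Γ) v
  set W := {w : V | Γᶜ.Reachable v w} with hWdef
  have hvW : v ∈ W := SimpleGraph.Reachable.refl v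
  change artinGrowthRate (Γ.induce W) < _ at h
  have hL1 : 1 ≤ artinGrowthRate (Γ.induce W) := one_le_artinGrowthRate
  set ρ := artinGrowthRate Γ with hρ
  have hR : ρ ≤ artinGrowthRate (Γ.induce Wᶜ) :=
    (le_max_iff.1 (artinGrowthRate_le_max hW)).resolve_left (not_le.2 h)
  obtain ⟨μ, hμ1, hμ2⟩ := exists_between h
  obtain ⟨K, hK0, hK⟩ := exists_sph_le_mul_pow hμ1
  obtain ⟨c, hc0, hc⟩ := exists_mul_pow_mul_sph_le _ (hL1.trans_lt h) hR
  have hρ0 : 0 < ρ := by linarith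
  have hμ0 : 0 < μ := by linarith
  have hq0 : 0 ≤ μ / ρ := by positivity
  have hq1 : μ / ρ < 1 := (div_lt_one hρ0).2 hμ2
  -- `D` is `K / c` times the sum of the geometric series in μ/ρ; it bounds the size of a sphere of
  -- the group relative to that of the complementary factor.
  set D := K / c * (1 - μ / ρ)⁻¹ with hD
  have hD0 : 0 < D := by
    have : 0 < 1 - μ / ρ := by linarith
    positivity
  refine ⟨1 / D, by positivity, fun n => ?_⟩
  -- Elements with trivial component in the factor of `v` contain no power of `v`, and they are
  -- counted by the sphere of the complementary factor.
  have hnum : sph (Γ.induce Wᶜ) n ≤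
      (sphere (stdGens Γ) n ∩ {g | vertexExcursion Γ v g = 0}).ncard := by
    have h1 : (sphere (stdGens Γ) n ∩ {g | retr Γ W g ∈ ({1} : Set _)}).ncard ≤
        (sphere (stdGens Γ) n ∩ {g | vertexExcursion Γ v g = 0}).ncard := by
      refine Set.ncard_le_ncard (Set.inter_subset_inter_right _ fun g hg => ?_)
        ((finite_sphere n).subset Set.inter_subset_left)
      by_contra hne
      have hg1 : retr Γ W g = 1 := hg
      have hpow : ∀ k : ℤ, k.natAbs = 1 → ¬HasPow v k g := by
        intro k hk hp
        rw [hasPow_iff hW hvW, hg1] at hp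
        obtain ⟨a, b, -, hab⟩ := hp
        rw [len_one] at hab
        omega
      rcases hasPow_of_le_vertexExcursion (n := 1) le_rfl (Nat.one_le_iff_ne_zero.2 hne)
        with h | h
      · exact hpow _ (by simp) h
      · exact hpow _ (by simp) h
    refine le_trans ?_ h1
    rw [ncard_sphere_inter_split hW]
    have h2 : (sphere (stdGens (Γ.induce W)) 0 ∩ {1}).ncard = 1 := by
      rw [Set.inter_eq_right.2 (by
        rintro g rfl
        exact len_one), Set.ncard_singleton]
    have := Finset.single_le_sum (f := fun p : ℕ × ℕ =>
      (sphere (stdGens (Γ.induce W)) p.1 ∩ {1}).ncard * sph (Γ.induce Wᶜ) p.2)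
      (fun _ _ => Nat.zero_le _) (show ((0, n) : ℕ × ℕ) ∈ Finset.HasAntidiagonal.antidiagonal n by simp)
    simpa [h2] using this
  have hden : (sph Γ n : ℝ) ≤ D * sph (Γ.induce Wᶜ) n := by
    rw [sph_eq_conv hW, conv_eq_sum_range]
    calc _ ≤ ∑ i ∈ Finset.range (n + 1), K / c * (μ / ρ) ^ i * sph (Γ.induce Wᶜ) n := by
          refine Finset.sum_le_sum fun i hi => ?_
          have hi' : n - i + i = n := by rw [Finset.mem_range] at hi; omega
          have h1 := hc (n - i) i
          rw [hi'] at h1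
          have h2 : (sph (Γ.induce Wᶜ) (n - i) : ℝ) ≤
              sph (Γ.induce Wᶜ) n / (c * ρ ^ i) := by
            rw [le_div_iff₀ (by positivity)]
            linarith
          calc _ ≤ (K * μ ^ i) * (sph (Γ.induce Wᶜ) n / (c * ρ ^ i)) := by
                gcongr
                exact hK i
            _ = _ := by rw [div_pow]; field_simp
      _ = K / c * (∑ i ∈ Finset.range (n + 1), (μ / ρ) ^ i) * sph (Γ.induce Wᶜ) n := by
          rw [← Finset.sum_mul, ← Finset.mul_sum]
      _ ≤ _ := by
          rw [hD]
          gcongr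
          rw [← tsum_geometric_of_lt_one hq0 hq1]
          exact (summable_geometric_of_lt_one hq0 hq1).sum_le_tsum _ fun i _ => by positivity
  have hpos : (0 : ℝ) < sph Γ n := by exact_mod_cast sph_pos n
  change _ ≤ _ / (sph Γ n : ℝ)
  rw [le_div_iff₀ hpos, one_div, inv_mul_le_iff₀ hD0]
  refine hden.trans ?_
  gcongr

/-- Elements whose component in the factor of `v` has a long power of `v` are rare. -/
theorem exists_count_hasPow_le [Finite V] (v : V) :
    ∃ C : ℝ, 0 < C ∧ ∀ (n : ℕ) (k : ℤ), ((sphere (stdGens Γ) n ∩ {g | HasPow v k g}).ncard : ℝ) ≤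
      C * ((n : ℝ) + 1) / artinGrowthRate (factorGraph Γ v) ^ k.natAbs * sph Γ n := by
  have hW := adj_of_component (Γ := Γ) v
  obtain ⟨C, hC1, hC⟩ := exists_factorGraph_bounds (Γ := Γ) v
  have hL1 : 1 ≤ artinGrowthRate (factorGraph Γ v) := one_le_artinGrowthRate
  set L := artinGrowthRate (factorGraph Γ v)
  set W := {w : V | Γᶜ.Reachable v w} with hWdef
  have hvW : v ∈ W := SimpleGraph.Reachable.refl v
  refine ⟨C ^ 2, by positivity, fun n k => ?_⟩
  have hset : {g | HasPow v k g} = {g : ArtinGroup Γ | retr Γ W g ∈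
      {a | HasPow (Γ := Γ.induce W) ⟨v, hvW⟩ k a}} := Set.ext fun g => hasPow_iff hW hvW
  have hfac : ∀ m ≤ n, ((sphere (stdGens (Γ.induce W)) m ∩
      {a | HasPow (Γ := Γ.induce W) ⟨v, hvW⟩ k a}).ncard : ℝ) ≤
        C ^ 2 * ((n : ℝ) + 1) / L ^ k.natAbs * sph (Γ.induce W) m := by
    intro m hm
    have h1 := count_hasPow_le (Γ := Γ.induce W) ⟨v, hvW⟩ m k
    refine (Nat.cast_le.2 h1).trans ?_
    rw [Nat.cast_sum]
    -- Each cut leaves two pieces of total length m - |k|, so it accounts for at most C² L^(m - |k|)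
    -- elements.
    calc _ ≤ ∑ i ∈ Finset.range (m + 1), C ^ 2 / L ^ k.natAbs * L ^ m := by
          refine Finset.sum_le_sum fun i _ => ?_
          split_ifs with hi
          · rw [Nat.cast_mul]
            calc _ ≤ (C * L ^ i) * (C * L ^ (m - k.natAbs - i)) := by
                  gcongr
                  · exact (hC _).2
                  · exact (hC _).2
              _ = _ := by
                  have : L ^ m = L ^ i * L ^ (m - k.natAbs - i) * L ^ k.natAbs := by
                    rw [← pow_add, ← pow_add]
                    congr 1
                    omega
                  rw [this]
                  field_simp
          · rw [Nat.cast_zero]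
            positivity
      _ = C ^ 2 * ((m : ℝ) + 1) / L ^ k.natAbs * L ^ m := by
          rw [Finset.sum_const, Finset.card_range, nsmul_eq_mul]
          push_cast
          ring
      _ ≤ _ := by
          gcongr
          exact (hC m).1
  rw [hset, ncard_sphere_inter_split hW, sph_eq_sum hW, Nat.cast_sum, Nat.cast_sum,
    Finset.mul_sum]
  refine Finset.sum_le_sum fun p hp => ?_
  have hp' := Finset.HasAntidiagonal.mem_antidiagonal.1 hp
  rw [Nat.cast_mul, Nat.cast_mul, ← mul_assoc]
  exact mul_le_mul_of_nonneg_right (hfac p.1 (by omega)) (Nat.cast_nonneg _)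

/-- When the factor of `v` grows as fast as the group, elements without a power `v ^ k` are rare. -/
theorem exists_count_not_hasPow_le_mul [Finite V] (hΓ : ¬∀ x y : ArtinGroup Γ, x * y = y * x) (v : V)
    (h : artinGrowthRate (factorGraph Γ v) = artinGrowthRate Γ) :
    ∃ C : ℝ, 0 < C ∧ ∀ n M k : ℕ, M ≤ n → 1 ≤ k →
      ((sphere (stdGens Γ) n ∩ {g | ¬HasPow v k g}).ncard : ℝ) ≤
        (C * ((M : ℝ) + 1) / ((n : ℝ) - M + 1) +
          C * ((k : ℝ) + 1) * artinGrowthRate Γ ^ k / ((M : ℝ) + 1)) * sph Γ n := by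
  obtain ⟨u', w', huw, hadj⟩ := exists_not_adj hΓ
  have hL2 : 2 ≤ artinGrowthRate Γ := two_le_artinGrowthRate huw hadj
  have hW := adj_of_component (Γ := Γ) v
  obtain ⟨C₀, hC₀1, hC₀⟩ := exists_factorGraph_bounds (Γ := Γ) v
  obtain ⟨A, hA⟩ := spread_sph (Γ.induce {w : V | Γᶜ.Reachable v w}ᶜ)
    (artinGrowthRate_induce_le (Γ := Γ) _)
  rw [h] at hC₀
  have hirr := preconnected_factorGraph (Γ := Γ) v
  -- A factor on a single vertex has growth rate at most 1, while the group has growth rate at least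
  -- 2.
  have hnt : Nontrivial {w : V | Γᶜ.Reachable v w} := by
    by_contra hs
    rw [not_nontrivial_iff_subsingleton] at hs
    have := artinGrowthRate_of_subsingleton (Γ := factorGraph Γ v)
    linarith
  set L := artinGrowthRate Γ with hL
  change ∀ n, L ^ n ≤ (sph (Γ.induce _) n : ℝ) ∧ (sph (Γ.induce _) n : ℝ) ≤ _ at hC₀
  change (Γ.induce _)ᶜ.Preconnected at hirr
  set W := {w : V | Γᶜ.Reachable v w} with hWdef
  have hvW : v ∈ W := SimpleGraph.Reachable.refl v
  obtain ⟨u, hu⟩ := hirr.exists_adj_of_nontrivial ⟨v, hvW⟩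
  rw [SimpleGraph.compl_adj] at hu
  obtain ⟨C₁, N, hcount⟩ := exists_count_not_hasPow_le hirr hu.1.symm fun h => hu.2 h.symm
  set t : ℕ → ℝ := fun n => sph (Γ.induce Wᶜ) n / L ^ n with ht
  have ht0 : ∀ n, 0 ≤ t n := fun n => by positivity
  have hL0 : 0 < L := by linarith
  have hA0 : 0 ≤ A := by
    have h0 : t 0 = 1 := by simp [ht, sph_zero]
    have := hA 0
    simp [h0] at this
    linarith
  have hT : ∀ n, L ^ n * ∑ i ∈ Finset.range (n + 1), t i ≤ sph Γ n := by
    intro n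
    rw [sph_eq_conv hW, conv_comm, conv_eq_sum_range, Finset.mul_sum]
    refine Finset.sum_le_sum fun i hi => ?_
    have hi' : n = i + (n - i) := by rw [Finset.mem_range] at hi; omega
    calc L ^ n * t i = sph (Γ.induce Wᶜ) i * L ^ (n - i) := by
          conv_lhs => rw [hi', pow_add]
          simp only [ht]
          field_simp
      _ ≤ _ := by
          gcongr
          exact (hC₀ _).1
  -- The sum of the constants of the two error terms; the 1 makes it positive.
  refine ⟨C₀ * A + C₁ * C₀ * L ^ N + 1, by positivity, fun n M k hM hk => ?_⟩
  have hset : {g | ¬HasPow v k g} = {g : ArtinGroup Γ | retr Γ W g ∈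
      {a | ¬HasPow (Γ := Γ.induce W) ⟨v, hvW⟩ k a}} :=
    Set.ext fun g => not_congr (hasPow_iff hW hvW)
  set E : Set (ArtinGroup (Γ.induce W)) :=
    {a | ¬HasPow (Γ := Γ.induce W) ⟨v, hvW⟩ k a} with hE
  have hE1 : ∀ m, (sphere (stdGens (Γ.induce W)) m ∩ E).ncard ≤ sph (Γ.induce W) m := fun m =>
    Set.ncard_le_ncard Set.inter_subset_left (finite_sphere m)
  set β : ℝ := C₁ * C₀ * L ^ N * ((k : ℝ) + 1) * L ^ k / ((M : ℝ) + 1) with hβ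
  have hβ0 : 0 ≤ β := by positivity
  have hE2 : ∀ m, M ≤ m → ((sphere (stdGens (Γ.induce W)) m ∩ E).ncard : ℝ) ≤
      β * sph (Γ.induce W) m := by
    intro m hm
    have h1 : ((m : ℝ) + 1) * (sphere (stdGens (Γ.induce W)) m ∩ E).ncard ≤
        C₁ * ((k : ℝ) + 1) * sph (Γ.induce W) (m + k + N) := by
      exact_mod_cast hcount m k hk
    have hm' : (M : ℝ) ≤ m := by exact_mod_cast hm
    calc ((sphere (stdGens (Γ.induce W)) m ∩ E).ncard : ℝ)
        ≤ C₁ * ((k : ℝ) + 1) * (C₀ * L ^ (m + k + N)) / ((m : ℝ) + 1) := by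
          rw [le_div_iff₀ (by positivity), mul_comm]
          refine h1.trans ?_
          gcongr
          exact (hC₀ _).2
      _ ≤ C₁ * ((k : ℝ) + 1) * (C₀ * L ^ (m + k + N)) / ((M : ℝ) + 1) := by gcongr
      _ = β * L ^ m := by
          rw [hβ, pow_add, pow_add]
          ring
      _ ≤ _ := by
          gcongr
          exact (hC₀ m).1
  have hMn : (M : ℝ) ≤ n := by exact_mod_cast hM
  have hd : 0 < (n : ℝ) - M + 1 := by linarith
  -- Elements whose component in the factor of `v` has length at most M: the other component has
  -- length at least n - M, and by spreading each such length carries a share of order 1/(n - M +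
  -- 1).
  have hfew : ∑ m ∈ Finset.range (M + 1),
      (sph (Γ.induce W) m : ℝ) * sph (Γ.induce Wᶜ) (n - m) ≤
        C₀ * A * ((M : ℝ) + 1) / ((n : ℝ) - M + 1) * sph Γ n := by
    calc _ ≤ ∑ m ∈ Finset.range (M + 1), C₀ * A / ((n : ℝ) - M + 1) * sph Γ n := by
          refine Finset.sum_le_sum fun m hm => ?_
          have hm' : m ≤ M := by rw [Finset.mem_range] at hm; omega
          have hmM : (m : ℝ) ≤ M := by exact_mod_cast hm'
          have hnm : ((n - m : ℕ) : ℝ) = (n : ℝ) - m := Nat.cast_sub (hm'.trans hM)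
          have hsum : ∑ i ∈ Finset.range (n - m + 1), t i ≤ ∑ i ∈ Finset.range (n + 1), t i :=
            Finset.sum_le_sum_of_subset_of_nonneg
              (Finset.range_subset_range.2 (by omega)) fun i _ _ => ht0 i
          have htm : ((n : ℝ) - M + 1) * t (n - m) ≤ A * ∑ i ∈ Finset.range (n + 1), t i := by
            calc _ ≤ (((n - m : ℕ) : ℝ) + 1) * t (n - m) := by
                  rw [hnm]
                  exact mul_le_mul_of_nonneg_right (by linarith) (ht0 _)
              _ ≤ _ := hA _
              _ ≤ _ := by gcongr
          have hn' : L ^ n = L ^ m * L ^ (n - m) := by rw [← pow_add]; congr 1; omega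
          calc (sph (Γ.induce W) m : ℝ) * sph (Γ.induce Wᶜ) (n - m)
              ≤ C₀ * L ^ m * sph (Γ.induce Wᶜ) (n - m) := by
                gcongr
                exact (hC₀ m).2
            _ = C₀ * L ^ n * t (n - m) := by
                rw [hn']
                simp only [ht]
                field_simp
            _ ≤ C₀ * L ^ n * (A * (∑ i ∈ Finset.range (n + 1), t i) / ((n : ℝ) - M + 1)) := by
                gcongr
                rw [le_div_iff₀ hd, mul_comm]
                exact htm
            _ = C₀ * A / ((n : ℝ) - M + 1) * (L ^ n * ∑ i ∈ Finset.range (n + 1), t i) := by ring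
            _ ≤ _ := by
                gcongr
                exact hT n
      _ = _ := by
          rw [Finset.sum_const, Finset.card_range, nsmul_eq_mul]
          push_cast
          ring
  have hmain : ((sphere (stdGens Γ) n ∩ {g | ¬HasPow v k g}).ncard : ℝ) ≤
      C₀ * A * ((M : ℝ) + 1) / ((n : ℝ) - M + 1) * sph Γ n + β * sph Γ n := by
    rw [hset, ncard_sphere_inter_split hW, Finset.Nat.sum_antidiagonal_eq_sum_range_succ
      (fun i j => (sphere (stdGens (Γ.induce W)) i ∩ E).ncard * sph (Γ.induce Wᶜ) j), Nat.cast_sum]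
    refine le_trans ?_ (add_le_add_left hfew _)
    nth_rw 1 [sph_eq_conv hW]
    rw [conv_eq_sum_range, Finset.mul_sum, Nat.succ_eq_add_one,
      ← Finset.sum_range_add_sum_Ico _ (show M + 1 ≤ n + 1 by omega),
      ← Finset.sum_range_add_sum_Ico (fun i => β * _) (show M + 1 ≤ n + 1 by omega)]
    have h1 : ∑ i ∈ Finset.range (M + 1), (((sphere (stdGens (Γ.induce W)) i ∩ E).ncard *
        sph (Γ.induce Wᶜ) (n - i) : ℕ) : ℝ) ≤ ∑ m ∈ Finset.range (M + 1),
          (sph (Γ.induce W) m : ℝ) * sph (Γ.induce Wᶜ) (n - m) := by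
      refine Finset.sum_le_sum fun i _ => ?_
      rw [Nat.cast_mul]
      gcongr
      exact hE1 i
    have h2 : ∑ i ∈ Finset.Ico (M + 1) (n + 1), (((sphere (stdGens (Γ.induce W)) i ∩ E).ncard *
        sph (Γ.induce Wᶜ) (n - i) : ℕ) : ℝ) ≤ ∑ i ∈ Finset.Ico (M + 1) (n + 1),
          β * ((sph (Γ.induce W) i : ℝ) * sph (Γ.induce Wᶜ) (n - i)) := by
      refine Finset.sum_le_sum fun i hi => ?_
      rw [Finset.mem_Ico] at hi
      rw [Nat.cast_mul, ← mul_assoc]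
      gcongr
      exact hE2 i (by omega)
    have h3 : 0 ≤ ∑ i ∈ Finset.range (M + 1),
        β * ((sph (Γ.induce W) i : ℝ) * sph (Γ.induce Wᶜ) (n - i)) :=
      Finset.sum_nonneg fun i _ => by positivity
    linarith
  refine hmain.trans ?_
  rw [← add_mul]
  gcongr
  · have : 0 ≤ C₁ * C₀ * L ^ N := by positivity
    linarith
  · rw [hβ]
    gcongr
    have : 0 ≤ C₀ * A := by positivity
    linarith

end Probability

/-! ### Choice of constants and the logarithmic law -/

section Asymptotics

theorem sqrt_quotient_le {n : ℕ} (hn : 4 ≤ n) :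
    ((Nat.sqrt n : ℝ) + 1) / ((n : ℝ) - Nat.sqrt n + 1) ≤ 3 * (n : ℝ) ^ (-(1 / 2) : ℝ) := by
  have hn' : (4 : ℝ) ≤ n := by exact_mod_cast hn
  have hM : (Nat.sqrt n : ℝ) ≤ √n := Real.nat_sqrt_le_real_sqrt
  have hs2 : 2 ≤ √(n : ℝ) := by
    rw [show (2 : ℝ) = √4 by rw [show (4 : ℝ) = 2 ^ 2 by norm_num]; simp]
    exact Real.sqrt_le_sqrt hn'
  have hsq : √(n : ℝ) * √n = n := Real.mul_self_sqrt (by linarith)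
  rw [Real.rpow_neg (by linarith), ← Real.sqrt_eq_rpow, ← div_eq_mul_inv,
    div_le_div_iff₀ (by nlinarith) (by linarith)]
  nlinarith

/-- Since k + 1 ≤ 2^k ≤ L^k, the product is at most L^(2k). The constant 1/8 makes this O(n^(1/4)),
which loses against the √n in the denominator of the error term. -/
theorem pow_ceil_le {L : ℝ} (hL : 2 ≤ L) {n : ℕ} (hn : 1 ≤ n) :
    ((⌈1 / (8 * Real.log L) * Real.log n⌉₊ : ℝ) + 1) *
      L ^ ⌈1 / (8 * Real.log L) * Real.log n⌉₊ ≤ L ^ 2 * (n : ℝ) ^ (1 / 4 : ℝ) := by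
  have hlog : 0 < Real.log L := Real.log_pos (by linarith)
  have hn' : (1 : ℝ) ≤ n := by exact_mod_cast hn
  have hln : 0 ≤ Real.log n := Real.log_nonneg hn'
  set k := ⌈1 / (8 * Real.log L) * Real.log n⌉₊ with hk
  have hk1 : (k : ℝ) < 1 / (8 * Real.log L) * Real.log n + 1 := Nat.ceil_lt_add_one (by positivity)
  have hk2 : (k : ℝ) + 1 ≤ L ^ k := by
    have : k + 1 ≤ 2 ^ k := Nat.lt_two_pow_self
    calc (k : ℝ) + 1 ≤ 2 ^ k := by exact_mod_cast this
      _ ≤ _ := by gcongr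
  have hL0 : 0 < L := by linarith
  calc ((k : ℝ) + 1) * L ^ k ≤ L ^ k * L ^ k := by gcongr
    _ = L ^ (2 * (k : ℝ)) := by
        rw [← pow_add, ← Real.rpow_natCast]
        congr 1
        push_cast
        ring
    _ ≤ L ^ (2 + 1 / (4 * Real.log L) * Real.log n : ℝ) := by
        refine Real.rpow_le_rpow_of_exponent_le (by linarith) ?_
        have : 1 / (4 * Real.log L) * Real.log n = 2 * (1 / (8 * Real.log L) * Real.log n) := by
          field_simp
          ring
        linarith
    _ = _ := by
        rw [Real.rpow_add hL0]
        congr 1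
        · exact Real.rpow_natCast L 2
        · rw [Real.rpow_def_of_pos hL0, Real.rpow_def_of_pos (by linarith)]
          congr 1
          field_simp

theorem sq_le_pow_ceil {L : ℝ} (hL : 2 ≤ L) {n : ℕ} (hn : 1 ≤ n) :
    (n : ℝ) ^ 2 ≤ L ^ ⌈2 / Real.log L * Real.log n⌉₊ := by
  have hlog : 0 < Real.log L := Real.log_pos (by linarith)
  have hn' : (1 : ℝ) ≤ n := by exact_mod_cast hn
  have hL0 : 0 < L := by linarith
  calc (n : ℝ) ^ 2 = L ^ (2 / Real.log L * Real.log n) := by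
        rw [Real.rpow_def_of_pos hL0, ← Real.rpow_natCast, Real.rpow_def_of_pos (by linarith)]
        congr 1
        push_cast
        field_simp
    _ ≤ L ^ (⌈2 / Real.log L * Real.log n⌉₊ : ℝ) :=
        Real.rpow_le_rpow_of_exponent_le (by linarith) (Nat.le_ceil _)
    _ = _ := Real.rpow_natCast _ _

/-- The three errors come from a short component (M = √n), a missing power `v ^ k`, and a too long
power of either sign, whence the factor 2. -/
theorem excursion_error_le {L C D : ℝ} (hL : 2 ≤ L) (hC : 0 < C) (hD : 0 < D) {n : ℕ}
    (hn : 4 ≤ n) :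
    C * ((Nat.sqrt n : ℝ) + 1) / ((n : ℝ) - Nat.sqrt n + 1) +
      C * ((⌈1 / (8 * Real.log L) * Real.log n⌉₊ : ℝ) + 1) *
        L ^ ⌈1 / (8 * Real.log L) * Real.log n⌉₊ / ((Nat.sqrt n : ℝ) + 1) +
      2 * (D * ((n : ℝ) + 1) / L ^ ⌈2 / Real.log L * Real.log n⌉₊) ≤
    3 * C * (n : ℝ) ^ (-(1 / 2) : ℝ) + C * L ^ 2 * (n : ℝ) ^ (-(1 / 4) : ℝ) +
      4 * D * (n : ℝ) ^ (-1 : ℝ) := by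
  have hn' : (4 : ℝ) ≤ n := by exact_mod_cast hn
  have hn0 : (0 : ℝ) < n := by linarith
  refine add_le_add (add_le_add ?_ ?_) ?_
  · rw [mul_div_assoc]
    calc _ ≤ C * (3 * (n : ℝ) ^ (-(1 / 2) : ℝ)) := by
          gcongr
          exact sqrt_quotient_le hn
      _ = _ := by ring
  · have hs : (n : ℝ) ^ (1 / 2 : ℝ) ≤ (Nat.sqrt n : ℝ) + 1 := by
      rw [← Real.sqrt_eq_rpow]
      exact Real.real_sqrt_le_nat_sqrt_succ
    calc _ = C * (((⌈1 / (8 * Real.log L) * Real.log n⌉₊ : ℝ) + 1) *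
          L ^ ⌈1 / (8 * Real.log L) * Real.log n⌉₊) / ((Nat.sqrt n : ℝ) + 1) := by ring
      _ ≤ C * (L ^ 2 * (n : ℝ) ^ (1 / 4 : ℝ)) / (n : ℝ) ^ (1 / 2 : ℝ) := by
          have := pow_ceil_le hL (show 1 ≤ n by omega)
          exact div_le_div₀ (by positivity) (mul_le_mul_of_nonneg_left this hC.le) (by positivity) hs
      _ = C * L ^ 2 * ((n : ℝ) ^ (1 / 4 : ℝ) / (n : ℝ) ^ (1 / 2 : ℝ)) := by ring
      _ = _ := by
          rw [← Real.rpow_sub hn0]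
          norm_num
  · calc _ ≤ 2 * (D * (2 * (n : ℝ)) / (n : ℝ) ^ 2) := by
          gcongr
          · linarith
          · exact sq_le_pow_ceil hL (by omega)
      _ = _ := by
          rw [Real.rpow_neg_one]
          field_simp
          norm_num

theorem tendsto_excursion_error (a b c : ℝ) :
    Tendsto (fun n : ℕ => a * (n : ℝ) ^ (-(1 / 2) : ℝ) + b * (n : ℝ) ^ (-(1 / 4) : ℝ) +
      c * (n : ℝ) ^ (-1 : ℝ)) atTop (𝓝 0) := by
  have key : ∀ y : ℝ, 0 < y → Tendsto (fun n : ℕ => (n : ℝ) ^ (-y)) atTop (𝓝 0) := fun y hy =>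
    (tendsto_rpow_neg_atTop hy).comp tendsto_natCast_atTop_atTop
  have := (((key (1 / 2) (by norm_num)).const_mul a).add
    ((key (1 / 4) (by norm_num)).const_mul b)).add ((key 1 one_pos).const_mul c)
  simpa using this

/-- When the factor of `v` grows as fast as the group, the excursion is logarithmic. -/
theorem exists_tendsto_sphereProb_log {V : Type*} {Γ : SimpleGraph V} [Finite V]
    (hΓ : ¬∀ x y : ArtinGroup Γ, x * y = y * x) (v : V)
    (h : artinGrowthRate (factorGraph Γ v) = artinGrowthRate Γ) :
    ∃ c₁ c₂ : ℝ, 0 < c₁ ∧ c₁ < c₂ ∧ Tendsto (fun n : ℕ => sphereProb (stdGens Γ) n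
      {g | c₁ * Real.log n ≤ (vertexExcursion Γ v g : ℝ) ∧
        (vertexExcursion Γ v g : ℝ) ≤ c₂ * Real.log n}) atTop (𝓝 1) := by
  have hV : Nonempty V := ⟨v⟩
  obtain ⟨C, hC0, hC⟩ := exists_count_not_hasPow_le_mul hΓ v h
  obtain ⟨D, hD0, hD⟩ := exists_count_hasPow_le (Γ := Γ) v
  rw [h] at hD
  obtain ⟨u, w, huw, hadj⟩ := exists_not_adj hΓ
  have hL : 2 ≤ artinGrowthRate Γ := two_le_artinGrowthRate huw hadj
  set L := artinGrowthRate Γ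
  have hlog : 0 < Real.log L := Real.log_pos (by linarith)
  refine ⟨1 / (8 * Real.log L), 2 / Real.log L, by positivity, ?_, ?_⟩
  · rw [div_lt_div_iff₀ (by positivity) hlog]
    linarith
  have herr := (tendsto_excursion_error (3 * C) (C * L ^ 2) (4 * D)).const_sub 1
  rw [sub_zero] at herr
  refine tendsto_of_tendsto_of_tendsto_of_le_of_le' herr tendsto_const_nhds ?_
    (Eventually.of_forall fun n => sphereProb_le_one n _)
  filter_upwards [eventually_ge_atTop 4] with n hn
  have hlogn : 0 < Real.log n := Real.log_pos (by exact_mod_cast (by omega : 1 < n))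
  set k := ⌈1 / (8 * Real.log L) * Real.log n⌉₊ with hk
  set m := ⌈2 / Real.log L * Real.log n⌉₊ with hm
  have hk1 : 1 ≤ k := Nat.one_le_ceil_iff.2 (by positivity)
  have hm1 : 1 ≤ m := Nat.one_le_ceil_iff.2 (by positivity)
  refine le_trans (sub_le_sub_left (excursion_error_le hL hC0 hD0 hn) 1) ?_
  refine one_sub_le_sphereProb
    (B := {g | ¬HasPow v k g} ∪ ({g | HasPow v m g} ∪ {g | HasPow v (-m) g})) ?_ ?_
  · intro g hg
    by_contra hcon
    simp only [Set.mem_union, Set.mem_ofPred_eq, not_or, not_not] at hcon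
    refine hg ⟨?_, ?_⟩
    · have := natAbs_le_vertexExcursion hcon.1
      rw [Int.natAbs_natCast] at this
      exact (Nat.le_ceil _).trans (by exact_mod_cast this)
    -- An excursion above c₂ log n is at least the integer `m`, and so yields a power of exponent
    -- `m` or `-m`.
    · by_contra hlt
      push Not at hlt
      rcases hasPow_of_le_vertexExcursion hm1 (Nat.ceil_le.2 hlt.le) with h | h
      · exact hcon.2.1 h
      · exact hcon.2.2 h
  · rw [Set.inter_union_distrib_left, Set.inter_union_distrib_left]
    have h1 := hC n (Nat.sqrt n) k (Nat.sqrt_le_self n) hk1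
    have h2 := hD n m
    have h3 := hD n (-m)
    rw [Int.natAbs_neg] at h3
    rw [Int.natAbs_natCast] at h2 h3
    have h4 : (((sphere (stdGens Γ) n ∩ {g | ¬HasPow v k g}) ∪
        ((sphere (stdGens Γ) n ∩ {g | HasPow v m g}) ∪
          (sphere (stdGens Γ) n ∩ {g | HasPow v (-m) g}))).ncard : ℝ) ≤
        (sphere (stdGens Γ) n ∩ {g | ¬HasPow v k g}).ncard +
          ((sphere (stdGens Γ) n ∩ {g | HasPow v m g}).ncard +
            (sphere (stdGens Γ) n ∩ {g | HasPow v (-m) g}).ncard) := by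
      exact_mod_cast (Set.ncard_union_le _ _).trans (Nat.add_le_add_left (Set.ncard_union_le _ _) _)
    linarith

end Asymptotics

end RAAG

theorem theoremT {V : Type*} [Finite V] (Γ : SimpleGraph V)
    (hΓ : ¬ ∀ x y : RAAG.ArtinGroup Γ, x * y = y * x) (v : V) :
    (RAAG.artinGrowthRate (RAAG.factorGraph Γ v) = RAAG.artinGrowthRate Γ →
      ∃ c₁ c₂ : ℝ, 0 < c₁ ∧ c₁ < c₂ ∧
        Tendsto (fun n : ℕ => RAAG.sphereProb (RAAG.stdGens Γ) n
          {g | c₁ * Real.log n ≤ (RAAG.vertexExcursion Γ v g : ℝ) ∧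
            (RAAG.vertexExcursion Γ v g : ℝ) ≤ c₂ * Real.log n}) atTop (𝓝 1)) ∧
    (RAAG.artinGrowthRate (RAAG.factorGraph Γ v) < RAAG.artinGrowthRate Γ →
      0 < liminf (fun n : ℕ => RAAG.sphereProb (RAAG.stdGens Γ) n
        {g | RAAG.vertexExcursion Γ v g = 0}) atTop) := by
  refine ⟨RAAG.exists_tendsto_sphereProb_log hΓ v, fun h => ?_⟩
  obtain ⟨δ, hδ, hle⟩ := RAAG.exists_le_sphereProb_vertexExcursion_eq_zero v h
  refine hδ.trans_le (le_liminf_of_le ?_ (Eventually.of_forall hle))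
  -- In ℝ the lower bound passes to the liminf only if the sequence does not run off to infinity;
  -- probabilities are at most 1.
  exact isCoboundedUnder_ge_of_le _ (x := 1) fun n => RAAG.sphereProb_le_one n _
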